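/- Let $\lambda=(\lambda_n)_{n\ge1}$ be a frequency, that is, a strictly increasing sequence of non-negative real numbers with $\lambda_n\to\infty$, and let $k>\ell\ge 0$ be real numbers. For a sequence $a=(a_n)$ of complex numbers, $m\ge0$, $x>0$ and $s\in\mathbb{C}$, put $$R_x^{\lambda,m}(a)(s)=\sum_{\lambda_n<x}a_n e^{-\lambda_n s}\Big(1-\frac{\lambda_n}{x}\Big)^m .$$ Let $H_{\infty,\ell}^{\lambda}[\mathrm{Re}>0]$ be the set of all holomorphic functions $f$ on $[\mathrm{Re}>0]=\{s\in\mathbb{C}:\mathrm{Re}\,s>0\}$ such that $$\|f\|_{\infty,\ell}=\sup_{\mathrm{Re}\,s>0}\frac{|f(s)|}{(1+|s|)^{\ell}}<\infty$$ and such that $f$ has a $\lambda$-Riesz germ, i.e. a Dirichlet series $\sum a_ne^{-\lambda_n s}$ for which there are $m\ge0$ and $\sigma_0\ge0$ with $f(s)=\lim_{x\to\infty}R_x^{\lambda,m}(a)(s)$ for all $s$ with $\mathrm{Re}\,s>\sigma_0$. For such $f$ with germ $\sum a_ne^{-\lambda_ns}$, write $R_x^{\lambda,k}(f)=R_x^{\lambda,k}(a)$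 for its Riesz means of order $k$. Then there is a constant $C=C(k,\ell,\lambda)>0$ such that for all $f\in H_{\infty,\ell}^{\lambda}[\mathrm{Re}>0]$ $$\sup_{x>0}\|R_x^{\lambda,k}(f)\|_{\infty,\ell}\le C\,\|f\|_{\infty,\ell}.$$ In particular, for every $\sigma\ge0$ there is a constant $C=C(k,\ell,\lambda,\sigma)>0$ such that for all $f\in H_{\infty,\ell}^{\lambda}[\mathrm{Re}>0]$ and all $t\in\mathbb{R}$ $$\sup_{x>0}|R_x^{\lambda,k}(f)(\sigma+it)|\le C\,(1+|t|)^{\ell}\,\|f\|_{\infty,\ell}.$$ -/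

import Mathlib

open scoped ENNReal Topology
open Filter

/-- A frequency: a strictly increasing sequence of non-negative real numbers that tends to `∞`
(indexed from `0`). -/
structure IsFrequency (lam : ℕ → ℝ) : Prop where
  strictMono : StrictMono lam
  nonneg : ∀ n, 0 ≤ lam n
  tendsto_atTop : Tendsto lam atTop atTop

/-- Only finitely many terms of a frequency lie below `x`, so the sums in `rieszMean` are finite. -/
theorem IsFrequency.finite_lt {lam : ℕ → ℝ} (h : IsFrequency lam) (x : ℝ) :
    {n : ℕ | lam n < x}.Finite := by
  obtain ⟨N, hN⟩ := (h.tendsto_atTop.eventually_ge_atTop x).exists_forall_of_atTop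
  refine (Set.finite_Iio N).subset fun n hn => ?_
  by_contra hc
  exact absurd (hN n (not_lt.mp hc)) (not_le.mpr hn)

/-- The open right half-plane `[Re > 0]`. -/
def rightHalfPlane : Set ℂ := {s : ℂ | 0 < s.re}

/-- The Riesz mean of order `k` and length `x`, at the point `s`, of the Dirichlet series
`∑ a n * exp (- lam n * s)`, namely
`∑_{lam n < x} a n * exp (- lam n * s) * (1 - lam n / x) ^ k`. -/
noncomputable def rieszMean (lam : ℕ → ℝ) (k : ℝ) (a : ℕ → ℂ) (x : ℝ) (s : ℂ) : ℂ :=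
  ∑ᶠ n ∈ {n : ℕ | lam n < x},
    a n * Complex.exp (-(lam n : ℂ) * s) * (((1 - lam n / x) ^ k : ℝ) : ℂ)

/-- The Dirichlet series with coefficients `a` is a Riesz germ of the function `f` on `[Re > 0]`:
for some order `m ≥ 0`, its Riesz means of order `m` converge to `f` pointwise on some
half-plane `[Re > σ]` contained in `[Re > 0]`. -/
def IsRieszGerm (lam : ℕ → ℝ) (a : ℕ → ℂ) (f : ℂ → ℂ) : Prop :=
  ∃ m : ℝ, 0 ≤ m ∧ ∃ σ : ℝ, 0 ≤ σ ∧ ∀ s : ℂ, σ < s.re →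
    Tendsto (fun x : ℝ => rieszMean lam m a x s) atTop (𝓝 (f s))

/-- The norm `‖f‖_{∞,ℓ} = sup_{Re s > 0} |f s| / (1 + |s|) ^ ℓ`, with values in `[0, ∞]`. -/
noncomputable def growthNorm (l : ℝ) (f : ℂ → ℂ) : ℝ≥0∞ :=
  ⨆ s ∈ rightHalfPlane, ENNReal.ofReal (‖f s‖ / (1 + ‖s‖) ^ l)

/-- Membership in `H_{∞,ℓ}^λ[Re > 0]`: `f` is holomorphic on `[Re > 0]`, has finite norm
`‖f‖_{∞,ℓ}`, and is generated by a Riesz germ. The values of `f` off `[Re > 0]` play no role. -/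
structure MemHInfty (lam : ℕ → ℝ) (l : ℝ) (f : ℂ → ℂ) : Prop where
  differentiableOn : DifferentiableOn ℂ f rightHalfPlane
  growthNorm_lt_top : growthNorm l f < ∞
  exists_germ : ∃ a : ℕ → ℂ, IsRieszGerm lam a f

/-! The theorem rests on Perron's formula for `k > l`: for `Re s > 0` and `c > 0`, with `z` on the
line `Re z = c`, `R_x^k(f)(s) = Γ(k+1)/(2π) · x^(-k) ∫ f(s+z) e^(xz) z^(-k-1) d(Im z)`
(`IsFrequency.perronIntegral_eq`). Take `c = 1/x`. Then `|e^(xz)| = e`, and `|f(s+z)|` is at most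
`‖f‖ (1+|s|)^l (x+1)^l |z|^l`. The integral of `|z|^(-(k+1-l))` over the line is `x^(k-l)` times a
constant, finite because `k > l`. The powers of `x` multiply to `(1+1/x)^l`, which is bounded for `x
≥ lam 1`. For `x ≤ lam 1` the mean has at most one term, whose weight increases with `x`, so the
case `x = lam 1` dominates.

The difficulty is that the germ is only summable by some order `m`, far to the right. There `m` is
raised to an integer `M` (`IsFrequency.tendsto_rieszMean_of_le`), and partial summation bounds the
means of order `M` by `O((1+|z|)^(M+1))` on vertical lines, uniformly in the length
(`IsFrequency.exists_norm_rieszMean_add_le`). Dominated convergence carries Perron's formula from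
finite sums to `f` for orders `K > M+1`. Differentiation in `x` lowers the order by one as long as
it stays above `l` (`IsFrequency.perronIntegral_eq_of_succ`), which reaches `k`. Both sides are
holomorphic in `s`, so the identity theorem extends the formula to `Re s > 0`. -/

/-! ### Truncated powers and Riesz means as finite sums -/

/-- The truncated power `y₊ ^ K`, which is `0` for `y ≤ 0` (also when `K = 0`). -/
noncomputable def truncPow (K y : ℝ) : ℝ := if 0 < y then y ^ K else 0

theorem truncPow_of_pos {K y : ℝ} (hy : 0 < y) : truncPow K y = y ^ K := if_pos hy

theorem truncPow_of_nonpos {K y : ℝ} (hy : y ≤ 0) : truncPow K y = 0 := if_neg hy.not_gt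

theorem truncPow_nonneg (K y : ℝ) : 0 ≤ truncPow K y := by
  unfold truncPow
  split_ifs with h
  · positivity
  · exact le_rfl

theorem measurable_truncPow (K : ℝ) : Measurable (truncPow K) :=
  Measurable.ite measurableSet_Ioi (by fun_prop) measurable_const

theorem truncPow_le_one {K y : ℝ} (hK : 0 ≤ K) (hy : y ≤ 1) : truncPow K y ≤ 1 := by
  unfold truncPow
  split_ifs with h
  · exact Real.rpow_le_one h.le hy hK
  · exact zero_le_one

theorem truncPow_mul {K c : ℝ} (hc : 0 < c) (y : ℝ) :
    truncPow K (c * y) = c ^ K * truncPow K y := by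
  rcases le_or_gt y 0 with hy | hy
  · rw [truncPow_of_nonpos hy, truncPow_of_nonpos (mul_nonpos_of_nonneg_of_nonpos hc.le hy),
      mul_zero]
  · rw [truncPow_of_pos hy, truncPow_of_pos (mul_pos hc hy), Real.mul_rpow hc.le hy.le]

/-- Passes between the normalised Riesz weights and the weights `(x - y)₊ ^ K` that Perron's formula
produces. -/
theorem truncPow_one_sub_div {K x : ℝ} (hx : 0 < x) (y : ℝ) :
    truncPow K (1 - y / x) = x ^ (-K) * truncPow K (x - y) := by
  have : x - y = x * (1 - y / x) := by field_simp
  rw [this, truncPow_mul hx, ← mul_assoc, ← Real.rpow_add hx]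
  simp

/-- Riesz means as sums of truncated powers over any sufficiently large finite set. -/
theorem rieszMean_eq_sum {lam : ℕ → ℝ} {S : Finset ℕ} {x : ℝ} (hx : 0 < x)
    (hS : ∀ n, lam n < x → n ∈ S) (K : ℝ) (a : ℕ → ℂ) (s : ℂ) :
    rieszMean lam K a x s =
      ∑ n ∈ S, a n * Complex.exp (-(lam n : ℂ) * s) * (truncPow K (1 - lam n / x) : ℂ) := by
  classical
  have key : ∀ n, lam n < x ↔ 0 < 1 - lam n / x := fun n => by rw [sub_pos, div_lt_one hx]
  have hset : {n : ℕ | lam n < x} = ((S.filter fun n => lam n < x : Finset ℕ) : Set ℕ) := by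
    ext n
    simpa using hS n
  rw [rieszMean, hset, finsum_mem_coe_finset, Finset.sum_filter]
  refine Finset.sum_congr rfl fun n _ => ?_
  split_ifs with h
  · rw [truncPow_of_pos ((key n).1 h)]
  · rw [truncPow_of_nonpos (not_lt.1 (mt (key n).2 h))]
    simp

/-- The finite set of indices `n` with `lam n < x`. -/
noncomputable def IsFrequency.below {lam : ℕ → ℝ} (h : IsFrequency lam) (x : ℝ) : Finset ℕ :=
  (h.finite_lt x).toFinset

theorem IsFrequency.mem_below {lam : ℕ → ℝ} (h : IsFrequency lam) {x : ℝ} {n : ℕ} :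
    n ∈ h.below x ↔ lam n < x := by
  simp [IsFrequency.below]

theorem IsFrequency.rieszMean_eq_sum_below {lam : ℕ → ℝ} (h : IsFrequency lam) {x X : ℝ}
    (hx : 0 < x) (hX : x ≤ X) (K : ℝ) (a : ℕ → ℂ) (s : ℂ) :
    rieszMean lam K a x s =
      ∑ n ∈ h.below X, a n * Complex.exp (-(lam n : ℂ) * s) *
        (truncPow K (1 - lam n / x) : ℂ) :=
  rieszMean_eq_sum hx (fun _ hn => h.mem_below.2 (hn.trans_le hX)) K a s

/-! ### Consistency: raising the order of summation -/

/-- Riesz means that converge as `x → ∞` are bounded on `x > 0`. -/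
theorem IsFrequency.rieszMean_bounded_of_tendsto {lam : ℕ → ℝ} (h : IsFrequency lam) {m : ℝ}
    (hm : 0 ≤ m) {a : ℕ → ℂ} {s L : ℂ}
    (hL : Tendsto (fun x : ℝ => rieszMean lam m a x s) atTop (𝓝 L)) :
    ∃ A : ℝ, 0 ≤ A ∧ ∀ x : ℝ, 0 < x → ‖rieszMean lam m a x s‖ ≤ A := by
  obtain ⟨X, hX⟩ := (hL.norm.eventually (gt_mem_nhds (lt_add_one ‖L‖))).exists_forall_of_atTop
  -- For `x ≤ X` only these indices occur, each with a weight at most `1`.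
  set B := ∑ n ∈ h.below X, ‖a n * Complex.exp (-(lam n : ℂ) * s)‖
  have hB : 0 ≤ B := Finset.sum_nonneg fun _ _ => norm_nonneg _
  refine ⟨max (‖L‖ + 1) B, le_max_of_le_right hB, fun x hx => ?_⟩
  rcases le_total X x with hXx | hxX
  · exact (hX x hXx).le.trans (le_max_left _ _)
  · refine le_trans ?_ (le_max_right _ _)
    rw [h.rieszMean_eq_sum_below hx hxX]
    refine (norm_sum_le _ _).trans (Finset.sum_le_sum fun n _ => ?_)
    rw [norm_mul, Complex.norm_real, Real.norm_of_nonneg (truncPow_nonneg _ _)]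
    refine mul_le_of_le_one_right (norm_nonneg _) (truncPow_le_one hm ?_)
    have := div_nonneg (h.nonneg n) hx.le
    linarith

/-- Raising the order of a truncated power by averaging against `(1 - v) ^ r`. -/
theorem integral_one_sub_rpow_mul_truncPow {m r θ : ℝ} (hθ : 0 ≤ θ) :
    ∫ v in (0 : ℝ)..1, (1 - v) ^ r * truncPow m (v - θ) =
      truncPow (m + r + 1) (1 - θ) * ∫ u in (0 : ℝ)..1, (1 - u) ^ r * truncPow m u := by
  rcases le_or_gt 1 θ with h1 | h1
  · rw [truncPow_of_nonpos (by linarith), zero_mul]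
    refine intervalIntegral.integral_zero_ae (Eventually.of_forall fun v hv => ?_)
    rw [Set.uIoc_of_le zero_le_one] at hv
    rw [truncPow_of_nonpos (by linarith [hv.2]), mul_zero]
  have hpos : 0 < 1 - θ := by linarith
  set g : ℝ → ℝ := fun v => (1 - v) ^ r * truncPow m (v - θ)
  -- The affine map of `[0, 1]` onto `[θ, 1]`; by homogeneity the powers of `1 - θ` then factor out.
  have hsub : ∫ u in (0 : ℝ)..1, g ((1 - θ) * u + θ) = (1 - θ)⁻¹ * ∫ v in θ..1, g v := by
    rw [intervalIntegral.integral_comp_mul_add g hpos.ne' θ]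
    simp
  have hzero : ∫ v in (0 : ℝ)..1, g v = ∫ v in θ..1, g v := by
    rw [intervalIntegral.integral_of_le zero_le_one, intervalIntegral.integral_of_le h1.le]
    refine MeasureTheory.setIntegral_eq_of_subset_of_forall_sdiff_eq_zero measurableSet_Ioc
      (Set.Ioc_subset_Ioc_left hθ) fun v hv => ?_
    have : v ≤ θ := by
      by_contra hc
      exact hv.2 ⟨not_le.1 hc, hv.1.2⟩
    simp only [g]
    rw [truncPow_of_nonpos (by linarith), mul_zero]
  have hcomp : ∫ u in (0 : ℝ)..1, g ((1 - θ) * u + θ) =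
      (1 - θ) ^ (m + r) * ∫ u in (0 : ℝ)..1, (1 - u) ^ r * truncPow m u := by
    rw [← intervalIntegral.integral_const_mul]
    refine intervalIntegral.integral_congr fun u hu => ?_
    rw [Set.uIcc_of_le zero_le_one] at hu
    simp only [g]
    rw [show 1 - ((1 - θ) * u + θ) = (1 - θ) * (1 - u) by ring, add_sub_cancel_right,
      truncPow_mul hpos, Real.mul_rpow hpos.le (by linarith [hu.2]), Real.rpow_add hpos]
    ring
  rw [hzero, truncPow_of_pos hpos, Real.rpow_add hpos, Real.rpow_one, mul_right_comm, ← hcomp,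
    hsub]
  field_simp

theorem intervalIntegrable_one_sub_rpow_mul_truncPow {m r : ℝ} (hm : 0 ≤ m) (hr : 0 ≤ r)
    {θ : ℝ} (hθ : 0 ≤ θ) :
    IntervalIntegrable (fun v => (1 - v) ^ r * truncPow m (v - θ)) MeasureTheory.volume 0 1 := by
  refine (intervalIntegrable_const (c := (1 : ℝ))).mono_fun' ?_ ?_
  · exact Measurable.aestronglyMeasurable
      (by have := measurable_truncPow m; fun_prop)
  · rw [Set.uIoc_of_le zero_le_one]
    refine (MeasureTheory.ae_restrict_iff' measurableSet_Ioc).2 (Eventually.of_forall fun v hv => ?_)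
    have h1 : 0 ≤ (1 - v) ^ r := Real.rpow_nonneg (by linarith [hv.2]) _
    have h2 := truncPow_nonneg m (v - θ)
    simp only [Real.norm_of_nonneg (mul_nonneg h1 h2)]
    exact mul_le_one₀ (Real.rpow_le_one (by linarith [hv.2]) (by linarith [hv.1]) hr) h2
      (truncPow_le_one hm (by linarith [hv.2]))

theorem integral_one_sub_rpow_mul_truncPow_pos {m r : ℝ} (hm : 0 ≤ m) (hr : 0 ≤ r) :
    0 < ∫ u in (0 : ℝ)..1, (1 - u) ^ r * truncPow m u := by
  refine intervalIntegral.intervalIntegral_pos_of_pos_on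
    (by simpa using intervalIntegrable_one_sub_rpow_mul_truncPow hm hr le_rfl) (fun u hu => ?_)
    zero_lt_one
  rw [truncPow_of_pos hu.1]
  exact mul_pos (Real.rpow_pos_of_pos (by linarith [hu.2]) _) (Real.rpow_pos_of_pos hu.1 _)

/-- Riesz means of higher order are averages of those of lower order. -/
theorem IsFrequency.integral_rieszMean {lam : ℕ → ℝ} (h : IsFrequency lam) {m r x : ℝ}
    (hm : 0 ≤ m) (hr : 0 ≤ r) (hx : 0 < x) (a : ℕ → ℂ) (s : ℂ) :
    ∫ v in (0 : ℝ)..1, (((1 - v) ^ r * truncPow m v : ℝ) : ℂ) * rieszMean lam m a (x * v) s =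
      rieszMean lam (m + r + 1) a x s *
        ((∫ u in (0 : ℝ)..1, (1 - u) ^ r * truncPow m u : ℝ) : ℂ) := by
  have hcongr : ∫ v in (0 : ℝ)..1,
        (((1 - v) ^ r * truncPow m v : ℝ) : ℂ) * rieszMean lam m a (x * v) s =
      ∫ v in (0 : ℝ)..1, ∑ n ∈ h.below x, a n * Complex.exp (-(lam n : ℂ) * s) *
        (((1 - v) ^ r * truncPow m (v - lam n / x) : ℝ) : ℂ) := by
    refine intervalIntegral.integral_congr_ae (Eventually.of_forall fun v hv => ?_)
    rw [Set.uIoc_of_le zero_le_one] at hv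
    rw [h.rieszMean_eq_sum_below (mul_pos hx hv.1) (mul_le_of_le_one_right hx.le hv.2),
      Finset.mul_sum]
    refine Finset.sum_congr rfl fun n _ => ?_
    -- The factor `v ^ m` of the averaging kernel clears the denominator in the weight of length `x
    -- * v`.
    have : truncPow m v * truncPow m (1 - lam n / (x * v)) = truncPow m (v - lam n / x) := by
      rw [truncPow_of_pos hv.1, ← truncPow_mul hv.1]
      congr 1
      have := hv.1.ne'
      field_simp
    rw [← this]
    push_cast
    ring
  rw [hcongr, intervalIntegral.integral_finsetSum]
  · rw [h.rieszMean_eq_sum_below hx le_rfl, Finset.sum_mul]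
    refine Finset.sum_congr rfl fun n _ => ?_
    rw [intervalIntegral.integral_const_mul, intervalIntegral.integral_ofReal,
      integral_one_sub_rpow_mul_truncPow (div_nonneg (h.nonneg n) hx.le)]
    push_cast
    ring
  · intro n _
    have := intervalIntegrable_one_sub_rpow_mul_truncPow hm hr (div_nonneg (h.nonneg n) hx.le)
    exact IntervalIntegrable.const_mul ⟨this.1.ofReal, this.2.ofReal⟩ _

/-- Consistency of Riesz summation: convergence persists when the order is raised. -/
theorem IsFrequency.tendsto_rieszMean_of_le {lam : ℕ → ℝ} (h : IsFrequency lam) {m M : ℝ}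
    (hm : 0 ≤ m) (hM : m + 1 ≤ M) {a : ℕ → ℂ} {s L : ℂ}
    (hL : Tendsto (fun x : ℝ => rieszMean lam m a x s) atTop (𝓝 L)) :
    Tendsto (fun x : ℝ => rieszMean lam M a x s) atTop (𝓝 L) := by
  obtain ⟨r, hr, rfl⟩ : ∃ r : ℝ, 0 ≤ r ∧ M = m + r + 1 := ⟨M - m - 1, by linarith, by ring⟩
  -- Boundedness at every positive length is needed, since `x * v` is arbitrarily small as `v → 0`.
  obtain ⟨A, hA0, hA⟩ := h.rieszMean_bounded_of_tendsto hm hL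
  set B := ∫ u in (0 : ℝ)..1, (1 - u) ^ r * truncPow m u
  have hB : (B : ℂ) ≠ 0 :=
    Complex.ofReal_ne_zero.2 (integral_one_sub_rpow_mul_truncPow_pos hm hr).ne'
  have hlim : Tendsto (fun x : ℝ => ∫ v in (0 : ℝ)..1,
      (((1 - v) ^ r * truncPow m v : ℝ) : ℂ) * rieszMean lam m a (x * v) s) atTop
      (𝓝 (∫ v in (0 : ℝ)..1, (((1 - v) ^ r * truncPow m v : ℝ) : ℂ) * L)) := by
    refine intervalIntegral.tendsto_integral_filter_of_dominated_convergence (fun _ => A) ?_ ?_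
      intervalIntegrable_const ?_
    · filter_upwards [eventually_gt_atTop 0] with x hx
      have hmeas := measurable_truncPow m
      refine MeasureTheory.AEStronglyMeasurable.congr (f := fun v : ℝ =>
        (((1 - v) ^ r * truncPow m v : ℝ) : ℂ) *
          ∑ n ∈ h.below x, a n * Complex.exp (-(lam n : ℂ) * s) *
            (truncPow m (1 - lam n / (x * v)) : ℂ)) ?_ ?_
      · exact Measurable.aestronglyMeasurable (by fun_prop)
      · rw [Set.uIoc_of_le zero_le_one]
        refine (MeasureTheory.ae_restrict_iff' measurableSet_Ioc).2
          (Eventually.of_forall fun v hv => ?_)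
        simp only
        rw [h.rieszMean_eq_sum_below (mul_pos hx hv.1) (mul_le_of_le_one_right hx.le hv.2)]
    · filter_upwards [eventually_gt_atTop 0] with x hx
      refine Eventually.of_forall fun v hv => ?_
      rw [Set.uIoc_of_le zero_le_one] at hv
      have h1 : 0 ≤ (1 - v) ^ r := Real.rpow_nonneg (by linarith [hv.2]) _
      have h2 := truncPow_nonneg m v
      rw [norm_mul, Complex.norm_real, Real.norm_of_nonneg (mul_nonneg h1 h2)]
      have h3 : (1 - v) ^ r * truncPow m v ≤ 1 :=
        mul_le_one₀ (Real.rpow_le_one (by linarith [hv.2]) (by linarith [hv.1]) hr) h2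
          (truncPow_le_one hm hv.2)
      calc _ ≤ 1 * A := mul_le_mul h3 (hA _ (mul_pos hx hv.1)) (norm_nonneg _) zero_le_one
        _ = A := one_mul A
    · refine Eventually.of_forall fun v hv => ?_
      rw [Set.uIoc_of_le zero_le_one] at hv
      exact (hL.comp (tendsto_id.atTop_mul_const hv.1)).const_mul _
  rw [intervalIntegral.integral_mul_const, intervalIntegral.integral_ofReal] at hlim
  have := hlim.mul_const (B : ℂ)⁻¹
  rw [mul_right_comm, mul_inv_cancel₀ hB, one_mul] at this
  refine this.congr' ?_
  filter_upwards [eventually_gt_atTop 0] with x hx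
  rw [h.integral_rieszMean hm hr hx, mul_assoc, mul_inv_cancel₀ hB, mul_one]

/-! ### Partial summation and growth on vertical lines -/

theorem iteratedDeriv_const_sub_ofReal_pow (t : ℝ) (M i : ℕ) :
    iteratedDeriv i (fun u : ℝ => ((t : ℂ) - u) ^ M) =
      fun u : ℝ => (-1) ^ i * (M.descFactorial i : ℂ) * ((t : ℂ) - u) ^ (M - i) := by
  induction i with
  | zero => simp
  | succ i ih =>
    rw [iteratedDeriv_succ, ih]
    funext u
    have h : HasDerivAt (fun u : ℝ => (t : ℂ) - u) (-1) u := by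
      simpa using (Complex.ofRealCLM.hasDerivAt (x := u)).const_sub (t : ℂ)
    rw [((h.fun_pow (M - i)).const_mul _).deriv, Nat.descFactorial_succ, Nat.sub_sub]
    push_cast
    ring

theorem iteratedDeriv_cexp_neg_mul_ofReal (z : ℂ) (i : ℕ) :
    iteratedDeriv i (fun u : ℝ => Complex.exp (-z * u)) =
      fun u : ℝ => (-z) ^ i * Complex.exp (-z * u) := by
  induction i with
  | zero => simp
  | succ i ih =>
    rw [iteratedDeriv_succ, ih]
    funext u
    have h : HasDerivAt (fun u : ℝ => -z * u) (-z) u := by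
      simpa using (Complex.ofRealCLM.hasDerivAt (x := u)).const_mul (-z)
    rw [((h.cexp).const_mul _).deriv]
    ring

theorem contDiff_const_sub_ofReal_pow (t : ℝ) (M : ℕ) {n : WithTop ℕ∞} :
    ContDiff ℝ n (fun u : ℝ => ((t : ℂ) - u) ^ M) :=
  (contDiff_const.sub Complex.ofRealCLM.contDiff).pow M

theorem contDiff_cexp_neg_mul_ofReal (z : ℂ) {n : WithTop ℕ∞} :
    ContDiff ℝ n (fun u : ℝ => Complex.exp (-z * u)) :=
  (contDiff_const.mul Complex.ofRealCLM.contDiff).cexp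

theorem iteratedDeriv_pow_mul_cexp (t : ℝ) (z : ℂ) (M n : ℕ) (u : ℝ) :
    iteratedDeriv n (fun u : ℝ => ((t : ℂ) - u) ^ M * Complex.exp (-z * u)) u =
      ∑ i ∈ Finset.range (n + 1), (n.choose i : ℂ) *
        ((-1) ^ i * (M.descFactorial i : ℂ) * ((t : ℂ) - u) ^ (M - i)) *
        ((-z) ^ (n - i) * Complex.exp (-z * u)) := by
  rw [iteratedDeriv_fun_mul (contDiff_const_sub_ofReal_pow t M).contDiffAt
    (contDiff_cexp_neg_mul_ofReal z).contDiffAt]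
  simp only [iteratedDeriv_const_sub_ofReal_pow, iteratedDeriv_cexp_neg_mul_ofReal]

/-- In each Leibniz term the polynomial factor costs at most `(1 + t) ^ M` and the exponential at
most `M + 1` factors `‖z‖`. The decay in `u` is kept, as it makes the later integral bounded in `t`.
-/
theorem exists_norm_iteratedDeriv_pow_mul_cexp_le (M : ℕ) :
    ∃ D : ℝ, 0 ≤ D ∧ ∀ (z : ℂ) (t u : ℝ), 0 ≤ u → u ≤ t →
      ‖iteratedDeriv (M + 1) (fun u : ℝ => ((t : ℂ) - u) ^ M * Complex.exp (-z * u)) u‖ ≤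
        D * (1 + t) ^ M * (1 + ‖z‖) ^ (M + 1) * Real.exp (-z.re * u) := by
  refine ⟨∑ i ∈ Finset.range (M + 1 + 1), ((M + 1).choose i : ℝ) * (M.descFactorial i : ℝ),
    by positivity, fun z t u hu hut => ?_⟩
  rw [iteratedDeriv_pow_mul_cexp, Finset.sum_mul, Finset.sum_mul, Finset.sum_mul]
  refine (norm_sum_le _ _).trans (Finset.sum_le_sum fun i _ => ?_)
  have h1 : ‖(t : ℂ) - u‖ ^ (M - i) ≤ (1 + t) ^ M := by
    rw [← Complex.ofReal_sub, Complex.norm_real, Real.norm_of_nonneg (by linarith)]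
    exact (pow_le_pow_left₀ (by linarith) (by linarith) _).trans
      (pow_le_pow_right₀ (by linarith) (Nat.sub_le _ _))
  have h2 : ‖z‖ ^ (M + 1 - i) ≤ (1 + ‖z‖) ^ (M + 1) :=
    (pow_le_pow_left₀ (norm_nonneg _) (by linarith) _).trans
      (pow_le_pow_right₀ (by linarith [norm_nonneg z]) (Nat.sub_le _ _))
  have h3 : ‖Complex.exp (-z * u)‖ = Real.exp (-z.re * u) := by
    rw [Complex.norm_exp]
    simp
  simp only [norm_mul, norm_pow, norm_neg, norm_one, one_pow, one_mul, Complex.norm_natCast, h3]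
  calc _ = ((M + 1).choose i : ℝ) * (M.descFactorial i : ℝ) * ‖(t : ℂ) - u‖ ^ (M - i) *
        ‖z‖ ^ (M + 1 - i) * Real.exp (-z.re * u) := by ring
    _ ≤ _ := by
        have : 0 ≤ t := hu.trans hut
        gcongr

/-- Taylor's formula with integral remainder, expanding `(t - u) ^ M * exp (-z * u)` about `u = t`
and evaluating at `u = lam`. Expanding the product, rather than the exponential alone, leaves a
single boundary term. -/
theorem pow_mul_cexp_eq_add_integral (z : ℂ) (M : ℕ) {lam t : ℝ} (h : lam < t) :
    ((t : ℂ) - lam) ^ M * Complex.exp (-z * lam) =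
      ((t : ℂ) - lam) ^ M * Complex.exp (-z * t) +
        (-1) ^ (M + 1) / (M.factorial : ℂ) * ∫ u in lam..t, ((u : ℂ) - lam) ^ M *
          iteratedDeriv (M + 1) (fun u : ℝ => ((t : ℂ) - u) ^ M * Complex.exp (-z * u)) u := by
  set φ : ℝ → ℂ := fun u : ℝ => ((t : ℂ) - u) ^ M * Complex.exp (-z * u) with hφ
  have hsm : ∀ {n : WithTop ℕ∞}, ContDiff ℝ n φ :=
    (contDiff_const_sub_ofReal_pow t M).mul (contDiff_cexp_neg_mul_ofReal z)
  have hud : UniqueDiffOn ℝ (Set.uIcc t lam) := uniqueDiffOn_uIcc h.ne'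
  have hw : ∀ n : ℕ, ∀ u ∈ Set.uIcc t lam,
      iteratedDerivWithin n φ (Set.uIcc t lam) u = iteratedDeriv n φ u := fun n u hu =>
    iteratedDerivWithin_eq_iteratedDeriv hud hsm.contDiffAt hu
  have key := taylor_integral_remainder (f := φ) (x := lam) (x₀ := t) (n := M) hsm.contDiffOn
  -- At `u = t` the derivatives of order below `M` vanish, and that of order `M` keeps only the term
  -- in which all derivatives fall on the power.
  have htaylor : taylorWithinEval φ M (Set.uIcc t lam) t lam =
      ((t : ℂ) - lam) ^ M * Complex.exp (-z * t) := by
    rw [taylor_within_apply, Finset.sum_eq_single_of_mem M (by simp)]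
    · rw [hw M t Set.left_mem_uIcc, hφ, iteratedDeriv_pow_mul_cexp,
        Finset.sum_eq_single_of_mem M (by simp)]
      · have : (M.factorial : ℂ) ≠ 0 := by exact_mod_cast M.factorial_ne_zero
        rw [Complex.real_smul]
        simp only [Nat.choose_self, Nat.descFactorial_self, Nat.sub_self, pow_zero]
        push_cast
        field_simp
        rw [← mul_pow]
        congr 1
        ring
      · intro i hi hne
        have : M - i ≠ 0 := by
          have := Finset.mem_range.1 hi
          omega
        simp [this]
    · intro j hj hne
      rw [hw j t Set.left_mem_uIcc, hφ, iteratedDeriv_pow_mul_cexp, Finset.sum_eq_zero, smul_zero]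
      intro i hi
      have : M - i ≠ 0 := by
        have := Finset.mem_range.1 hi
        have := Finset.mem_range.1 hj
        omega
      simp [this]
  rw [htaylor, sub_eq_iff_eq_add'] at key
  rw [show ((t : ℂ) - lam) ^ M * Complex.exp (-z * lam) = φ lam from rfl, key]
  congr 1
  rw [intervalIntegral.integral_symm, ← intervalIntegral.integral_const_mul,
    ← intervalIntegral.integral_neg]
  refine intervalIntegral.integral_congr fun u hu => ?_
  rw [hw _ u (by rwa [Set.uIcc_comm]), Complex.real_smul]
  push_cast
  rw [show (lam : ℂ) - u = -1 * ((u : ℂ) - lam) by ring, mul_pow]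
  ring

/-- Truncation makes the range of integration independent of `lam`, so that the identity can be
summed over all frequencies below `t`. -/
theorem truncPow_natCast_mul_cexp (z : ℂ) (M : ℕ) {lam t : ℝ} (h0 : 0 ≤ lam) (ht : 0 ≤ t) :
    (truncPow M (t - lam) : ℂ) * Complex.exp (-z * lam) =
      (truncPow M (t - lam) : ℂ) * Complex.exp (-z * t) +
        (-1) ^ (M + 1) / (M.factorial : ℂ) * ∫ u in (0 : ℝ)..t, (truncPow M (u - lam) : ℂ) *
          iteratedDeriv (M + 1) (fun u : ℝ => ((t : ℂ) - u) ^ M * Complex.exp (-z * u)) u := by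
  rcases le_or_gt t lam with h | h
  · rw [truncPow_of_nonpos (by linarith), intervalIntegral.integral_zero_ae]
    · simp
    · refine Eventually.of_forall fun u hu => ?_
      rw [Set.uIoc_of_le ht] at hu
      rw [truncPow_of_nonpos (by linarith [hu.2])]
      simp
  · have hint : ∫ u in (0 : ℝ)..t, (truncPow M (u - lam) : ℂ) *
          iteratedDeriv (M + 1) (fun u : ℝ => ((t : ℂ) - u) ^ M * Complex.exp (-z * u)) u =
        ∫ u in lam..t, ((u : ℂ) - lam) ^ M *
          iteratedDeriv (M + 1) (fun u : ℝ => ((t : ℂ) - u) ^ M * Complex.exp (-z * u)) u := by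
      rw [intervalIntegral.integral_of_le ht, intervalIntegral.integral_of_le h.le,
        MeasureTheory.setIntegral_eq_of_subset_of_forall_sdiff_eq_zero measurableSet_Ioc
          (Set.Ioc_subset_Ioc_left h0)]
      · refine MeasureTheory.setIntegral_congr_fun measurableSet_Ioc fun u hu => ?_
        rw [truncPow_of_pos (sub_pos.2 hu.1), Real.rpow_natCast]
        push_cast
        rfl
      · intro u hu
        have : u ≤ lam := by
          by_contra hc
          exact hu.2 ⟨not_le.1 hc, hu.1.2⟩
        rw [truncPow_of_nonpos (by linarith)]
        simp
    rw [hint, truncPow_of_pos (sub_pos.2 h), Real.rpow_natCast]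
    push_cast
    exact pow_mul_cexp_eq_add_integral z M h

theorem continuous_iteratedDeriv_pow_mul_cexp (t : ℝ) (z : ℂ) (M n : ℕ) :
    Continuous (iteratedDeriv n fun u : ℝ => ((t : ℂ) - u) ^ M * Complex.exp (-z * u)) :=
  ((contDiff_const_sub_ofReal_pow t M).mul
    (contDiff_cexp_neg_mul_ofReal z) : ContDiff ℝ n _).continuous_iteratedDeriv n le_rfl

/-- Partial summation: Riesz means of integral order at `s + z` in terms of those at `s`. -/
theorem IsFrequency.rieszMean_add_eq {lam : ℕ → ℝ} (h : IsFrequency lam) (M : ℕ) (a : ℕ → ℂ)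
    (s z : ℂ) {t : ℝ} (ht : 0 < t) :
    (t : ℂ) ^ M * rieszMean lam M a t (s + z) =
      (t : ℂ) ^ M * rieszMean lam M a t s * Complex.exp (-z * t) +
        (-1) ^ (M + 1) / (M.factorial : ℂ) * ∫ u in (0 : ℝ)..t,
          (u : ℂ) ^ M * rieszMean lam M a u s *
          iteratedDeriv (M + 1) (fun u : ℝ => ((t : ℂ) - u) ^ M * Complex.exp (-z * u)) u := by
  have hT : ∀ w : ℂ, ∀ u : ℝ, 0 < u → u ≤ t → (u : ℂ) ^ M * rieszMean lam M a u w =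
      ∑ n ∈ h.below t, a n * Complex.exp (-(lam n : ℂ) * w) * (truncPow M (u - lam n) : ℂ) := by
    intro w u hu hut
    rw [h.rieszMean_eq_sum_below hu hut, Finset.mul_sum]
    refine Finset.sum_congr rfl fun n _ => ?_
    have hu' : (u : ℂ) ^ M ≠ 0 := pow_ne_zero _ (Complex.ofReal_ne_zero.2 hu.ne')
    rw [truncPow_one_sub_div hu, Real.rpow_neg hu.le, Real.rpow_natCast]
    push_cast
    field_simp
  have hint : ∫ u in (0 : ℝ)..t, (u : ℂ) ^ M * rieszMean lam M a u s *
          iteratedDeriv (M + 1) (fun u : ℝ => ((t : ℂ) - u) ^ M * Complex.exp (-z * u)) u =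
      ∑ n ∈ h.below t, a n * Complex.exp (-(lam n : ℂ) * s) *
        ∫ u in (0 : ℝ)..t, (truncPow M (u - lam n) : ℂ) *
          iteratedDeriv (M + 1) (fun u : ℝ => ((t : ℂ) - u) ^ M * Complex.exp (-z * u)) u := by
    simp_rw [← intervalIntegral.integral_const_mul]
    rw [← intervalIntegral.integral_finsetSum]
    · refine intervalIntegral.integral_congr_ae (Eventually.of_forall fun u hu => ?_)
      rw [Set.uIoc_of_le ht.le] at hu
      rw [hT s u hu.1 hu.2, Finset.sum_mul]
      exact Finset.sum_congr rfl fun n _ => by ring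
    · intro n _
      refine IntervalIntegrable.const_mul (IntervalIntegrable.mul_continuousOn ?_
        (continuous_iteratedDeriv_pow_mul_cexp t z M (M + 1)).continuousOn) _
      have hI : IntervalIntegrable (fun u => truncPow M (u - lam n)) MeasureTheory.volume 0 t := by
        refine (intervalIntegrable_const (c := t ^ M)).mono_fun' ?_ ?_
        · exact Measurable.aestronglyMeasurable
            (by have := measurable_truncPow M; fun_prop)
        · rw [Set.uIoc_of_le ht.le]
          refine (MeasureTheory.ae_restrict_iff' measurableSet_Ioc).2
            (Eventually.of_forall fun u hu => ?_)
          have := h.nonneg n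
          simp only [Real.norm_of_nonneg (truncPow_nonneg _ _)]
          rcases le_or_gt (u - lam n) 0 with h0 | h0
          · rw [truncPow_of_nonpos h0]
            positivity
          · rw [truncPow_of_pos h0, Real.rpow_natCast]
            exact pow_le_pow_left₀ h0.le (by linarith [hu.2]) _
      exact ⟨hI.1.ofReal, hI.2.ofReal⟩
  rw [hT _ t ht le_rfl, hT _ t ht le_rfl, hint, Finset.sum_mul, Finset.mul_sum,
    ← Finset.sum_add_distrib]
  refine Finset.sum_congr rfl fun n _ => ?_
  have := truncPow_natCast_mul_cexp z M (h.nonneg n) ht.le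
  rw [show -(lam n : ℂ) * (s + z) = -(lam n : ℂ) * s + -z * lam n by ring, Complex.exp_add]
  linear_combination (a n * Complex.exp (-(lam n : ℂ) * s)) * this

/-- If the Riesz means of integral order `M` at `s` are bounded, then those at `s + z` grow at most
like `(1 + ‖z‖) ^ (M + 1)` along vertical lines. -/
theorem IsFrequency.exists_norm_rieszMean_add_le {lam : ℕ → ℝ} (h : IsFrequency lam) (M : ℕ)
    {a : ℕ → ℂ} {s : ℂ} {A : ℝ} (hA0 : 0 ≤ A)
    (hA : ∀ x : ℝ, 0 < x → ‖rieszMean lam M a x s‖ ≤ A) {c : ℝ} (hc : 0 < c) :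
    ∃ C : ℝ, 0 ≤ C ∧ ∀ z : ℂ, z.re = c → ∀ x : ℝ, 1 ≤ x →
      ‖rieszMean lam M a x (s + z)‖ ≤ C * (1 + ‖z‖) ^ (M + 1) := by
  obtain ⟨D, hD0, hD⟩ := exists_norm_iteratedDeriv_pow_mul_cexp_le M
  have hintegrable : MeasureTheory.IntegrableOn
      (fun u : ℝ => u ^ M * Real.exp (-c * u)) (Set.Ioi 0) := by
    have := integrableOn_rpow_mul_exp_neg_mul_rpow (p := 1) (s := M) (b := c)
      (by have : (0 : ℝ) ≤ M := M.cast_nonneg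
          linarith) one_pos hc
    simpa using this
  set I := ∫ u in Set.Ioi (0 : ℝ), u ^ M * Real.exp (-c * u)
  have hI0 : 0 ≤ I := MeasureTheory.setIntegral_nonneg measurableSet_Ioi fun u hu => by
    have := Set.mem_Ioi.1 hu
    positivity
  refine ⟨A + A * D * 2 ^ M * I, by positivity, fun z hz x hx => ?_⟩
  have hx0 : 0 < x := by linarith
  have hz1 : 1 ≤ (1 + ‖z‖) ^ (M + 1) := one_le_pow₀ (by linarith [norm_nonneg z])
  have hfirst : ‖(x : ℂ) ^ M * rieszMean lam M a x s * Complex.exp (-z * x)‖ ≤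
      x ^ M * (A * (1 + ‖z‖) ^ (M + 1)) := by
    have he : ‖Complex.exp (-z * x)‖ ≤ 1 := by
      rw [Complex.norm_exp, Real.exp_le_one_iff]
      simp only [Complex.mul_re, Complex.neg_re, Complex.ofReal_re, Complex.ofReal_im, mul_zero,
        sub_zero, hz]
      nlinarith
    rw [norm_mul, norm_mul, norm_pow, Complex.norm_real, Real.norm_of_nonneg hx0.le, mul_assoc]
    refine mul_le_mul_of_nonneg_left ?_ (by positivity)
    exact mul_le_mul (hA x hx0) (he.trans hz1) (norm_nonneg _) hA0
  have hsecond : ‖∫ u in (0 : ℝ)..x, (u : ℂ) ^ M * rieszMean lam M a u s *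
        iteratedDeriv (M + 1) (fun u : ℝ => ((x : ℂ) - u) ^ M * Complex.exp (-z * u)) u‖ ≤
      x ^ M * (A * D * 2 ^ M * I * (1 + ‖z‖) ^ (M + 1)) := by
    set E := A * D * (1 + x) ^ M * (1 + ‖z‖) ^ (M + 1)
    have hE0 : 0 ≤ E := by positivity
    calc _ ≤ ∫ u in (0 : ℝ)..x, E * (u ^ M * Real.exp (-c * u)) := by
          refine intervalIntegral.norm_integral_le_of_norm_le hx0.le
            (Eventually.of_forall fun u hu => ?_)
            (Continuous.intervalIntegrable (by fun_prop) _ _)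
          rw [norm_mul, norm_mul, norm_pow, Complex.norm_real, Real.norm_of_nonneg hu.1.le]
          have h1 := hD z x u hu.1.le hu.2
          rw [hz] at h1
          have hu0 : 0 ≤ u := hu.1.le
          calc _ ≤ u ^ M * A * (D * (1 + x) ^ M * (1 + ‖z‖) ^ (M + 1) * Real.exp (-c * u)) := by
                gcongr
                exact hA u hu.1
            _ = _ := by ring
      _ = E * ∫ u in Set.Ioc (0 : ℝ) x, u ^ M * Real.exp (-c * u) := by
          rw [intervalIntegral.integral_const_mul, intervalIntegral.integral_of_le hx0.le]
      _ ≤ E * I := by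
          refine mul_le_mul_of_nonneg_left (MeasureTheory.setIntegral_mono_set hintegrable ?_
            (Eventually.of_forall Set.Ioc_subset_Ioi_self)) hE0
          refine (MeasureTheory.ae_restrict_iff' measurableSet_Ioi).2
            (Eventually.of_forall fun u hu => ?_)
          have := Set.mem_Ioi.1 hu
          simp only [Pi.zero_apply]
          positivity
      _ ≤ (A * D * (2 * x) ^ M * (1 + ‖z‖) ^ (M + 1)) * I := by
          refine mul_le_mul_of_nonneg_right ?_ hI0
          -- Here `x ≥ 1` enters: `(1 + x) ^ M` becomes a multiple of `x ^ M`, which cancels at the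
          -- end.
          have : 1 + x ≤ 2 * x := by linarith
          simp only [E]
          gcongr
      _ = _ := by ring
  have hfac : ‖(-1) ^ (M + 1) / (M.factorial : ℂ)‖ ≤ 1 := by
    rw [norm_div, norm_pow, norm_neg, norm_one, one_pow, Complex.norm_natCast]
    exact div_le_one_of_le₀ (by exact_mod_cast M.factorial_pos) (Nat.cast_nonneg _)
  have hxM : 0 < x ^ M := by positivity
  refine le_of_mul_le_mul_left ?_ hxM
  calc x ^ M * ‖rieszMean lam M a x (s + z)‖
      = ‖(x : ℂ) ^ M * rieszMean lam M a x (s + z)‖ := by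
        rw [norm_mul, norm_pow, Complex.norm_real, Real.norm_of_nonneg hx0.le]
    _ ≤ x ^ M * (A * (1 + ‖z‖) ^ (M + 1)) +
        1 * (x ^ M * (A * D * 2 ^ M * I * (1 + ‖z‖) ^ (M + 1))) := by
        rw [h.rieszMean_add_eq M a s z hx0]
        refine (norm_add_le _ _).trans (add_le_add hfirst ?_)
        rw [norm_mul]
        exact mul_le_mul hfac hsecond (norm_nonneg _) zero_le_one
    _ = _ := by ring

/-! ### Holomorphic parameter integrals and the Laplace transform of a power -/

/-- An integral that depends holomorphically on a parameter, with a locally uniform integrable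
bound on the integrand, is holomorphic. -/
theorem differentiableOn_integral_of_locally_dominated {α : Type*} [MeasurableSpace α]
    {μ : MeasureTheory.Measure α} {U : Set ℂ} (hU : IsOpen U) {F : ℂ → α → ℂ}
    (hmeas : ∀ z ∈ U, MeasureTheory.AEStronglyMeasurable (F z) μ)
    (hdiff : ∀ t, DifferentiableOn ℂ (fun z => F z t) U)
    (hbound : ∀ z₀ ∈ U, ∃ r > 0, ∃ bound : α → ℝ, MeasureTheory.Integrable bound μ ∧
      ∀ᵐ t ∂μ, ∀ z ∈ Metric.ball z₀ r, ‖F z t‖ ≤ bound t) :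
    DifferentiableOn ℂ (fun z => ∫ t, F z t ∂μ) U := by
  intro z₀ hz₀
  obtain ⟨r₁, hr₁, bound, hbi, hb⟩ := hbound z₀ hz₀
  obtain ⟨r₂, hr₂, hball⟩ := Metric.isOpen_iff.1 hU z₀ hz₀
  set ρ := min r₁ r₂ / 2
  have hρ : 0 < ρ := by positivity
  have hsub : ∀ z ∈ Metric.ball z₀ ρ, Metric.closedBall z (ρ / 2) ⊆ Metric.ball z₀ (min r₁ r₂) := by
    intro z hz w hw
    rw [Metric.mem_ball] at hz ⊢
    rw [Metric.mem_closedBall] at hw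
    have := dist_triangle w z z₀
    simp only [ρ] at *
    linarith [lt_min hr₁ hr₂]
  have hsubU : Metric.ball z₀ (min r₁ r₂) ⊆ U :=
    (Metric.ball_subset_ball (min_le_right _ _)).trans hball
  have hderiv : ∀ t, ∀ z ∈ Metric.ball z₀ ρ,
      HasDerivAt (fun z => F z t) (deriv (fun z => F z t) z) z := fun t z hz =>
    ((hdiff t).differentiableAt (hU.mem_nhds (hsubU (hsub z hz
      (Metric.mem_closedBall_self (by positivity)))))).hasDerivAt
  -- The derivative is a limit of measurable difference quotients; the `n + 2` keeps every increment
  -- strictly below `ρ`.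
  have hmeas' : MeasureTheory.AEStronglyMeasurable (fun t => deriv (fun z => F z t) z₀) μ := by
    have hseq : ∀ n : ℕ, z₀ + ((ρ / (n + 2) : ℝ) : ℂ) ∈ Metric.ball z₀ ρ := by
      intro n
      rw [Metric.mem_ball, dist_eq_norm, add_sub_cancel_left, Complex.norm_real,
        Real.norm_of_nonneg (by positivity)]
      exact div_lt_self hρ (by have : (0 : ℝ) ≤ n := n.cast_nonneg
                               linarith)
    have hlim : Tendsto (fun n : ℕ => ((ρ / (n + 2) : ℝ) : ℂ)) atTop (𝓝[≠] 0) := by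
      refine tendsto_nhdsWithin_iff.2 ⟨?_, Eventually.of_forall fun n => ?_⟩
      · rw [← Complex.ofReal_zero]
        refine (Complex.continuous_ofReal.tendsto 0).comp ?_
        exact tendsto_const_nhds.div_atTop
          (tendsto_atTop_add_const_right _ _ tendsto_natCast_atTop_atTop)
      · exact Complex.ofReal_ne_zero.2 (by positivity)
    refine aestronglyMeasurable_of_tendsto_ae atTop
      (f := fun (n : ℕ) t => ((ρ / (n + 2) : ℝ) : ℂ)⁻¹ • (F (z₀ + ((ρ / (n + 2) : ℝ) : ℂ)) t - F z₀ t))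
      (fun n => ?_) (Eventually.of_forall fun t => ?_)
    · exact ((hmeas _ (hsubU (hsub _ (hseq n)
        (Metric.mem_closedBall_self (by positivity))))).sub (hmeas _ hz₀)).const_smul ((ρ / (n + 2) : ℝ) : ℂ)⁻¹
    · exact ((hderiv t z₀ (Metric.mem_ball_self hρ)).tendsto_slope_zero).comp hlim
  have hF := hasDerivAt_integral_of_dominated_loc_of_deriv_le (μ := μ) (F := F)
    (F' := fun z t => deriv (fun z => F z t) z) (x₀ := z₀) (s := Metric.ball z₀ ρ)
    (bound := fun t => bound t / (ρ / 2)) (Metric.ball_mem_nhds z₀ hρ)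
    ?_ ?_ hmeas' ?_ (hbi.div_const _) (Eventually.of_forall hderiv)
  · exact hF.2.differentiableAt.differentiableWithinAt
  · filter_upwards [hU.mem_nhds hz₀] with z hz using hmeas z hz
  · refine hbi.mono' (hmeas z₀ hz₀) ?_
    filter_upwards [hb] with t ht using ht z₀ (Metric.mem_ball_self hr₁)
  · filter_upwards [hb] with t ht z hz
    -- Cauchy's estimate on a circle of radius `ρ / 2` turns the bound on `F` into one on its
    -- derivative.
    refine Complex.norm_deriv_le_of_forall_mem_sphere_norm_le (by positivity) ?_ fun w hw => ?_
    · refine DifferentiableOn.diffContOnCl ?_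
      refine (hdiff t).mono ?_
      exact (Metric.closure_ball_subset_closedBall.trans (hsub z hz)).trans hsubU
    · exact ht w (Metric.ball_subset_ball (min_le_left _ _)
        (hsub z hz (Metric.sphere_subset_closedBall hw)))

theorem isOpen_rightHalfPlane : IsOpen rightHalfPlane :=
  isOpen_lt continuous_const Complex.continuous_re

theorem convex_rightHalfPlane : Convex ℝ rightHalfPlane :=
  convex_halfSpace_re_gt 0

/-- The Laplace transform of a power, at complex arguments. -/
theorem integral_rpow_mul_cexp_neg_mul_Ioi {K : ℝ} (hK : 0 < K) {z : ℂ} (hz : 0 < z.re) :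
    ∫ t in Set.Ioi (0 : ℝ), ((t ^ K : ℝ) : ℂ) * Complex.exp (-z * t) =
      (Real.Gamma (K + 1) : ℂ) / z ^ ((K + 1 : ℝ) : ℂ) := by
  have hnorm : ∀ (z : ℂ) (t : ℝ), 0 < t →
      ‖((t ^ K : ℝ) : ℂ) * Complex.exp (-z * t)‖ = t ^ K * Real.exp (-z.re * t) := by
    intro z t ht
    rw [norm_mul, Complex.norm_real, Real.norm_of_nonneg (by positivity), Complex.norm_exp]
    simp
  have hleft : DifferentiableOn ℂ (fun z : ℂ => ∫ t in Set.Ioi (0 : ℝ),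
      ((t ^ K : ℝ) : ℂ) * Complex.exp (-z * t)) rightHalfPlane := by
    refine differentiableOn_integral_of_locally_dominated isOpen_rightHalfPlane ?_ ?_ ?_
    · intro z _
      exact Measurable.aestronglyMeasurable (by fun_prop)
    · intro t
      fun_prop
    · intro z₀ hz₀
      have hz₀ : 0 < z₀.re := hz₀
      refine ⟨z₀.re / 2, by positivity, fun t => t ^ K * Real.exp (-(z₀.re / 2) * t), ?_, ?_⟩
      · have := integrableOn_rpow_mul_exp_neg_mul_rpow (p := 1) (s := K) (b := z₀.re / 2)
          (by linarith) one_pos (by positivity)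
        simp only [Real.rpow_one] at this
        exact this
      · refine (MeasureTheory.ae_restrict_iff' measurableSet_Ioi).2
          (Eventually.of_forall fun t ht z hz => ?_)
        have ht : 0 < t := ht
        rw [hnorm z t ht]
        have h1 : |(z - z₀).re| ≤ ‖z - z₀‖ := Complex.abs_re_le_norm _
        rw [Metric.mem_ball, dist_eq_norm] at hz
        rw [Complex.sub_re] at h1
        have h2 := (abs_le.1 h1).1
        have h3 : -z.re ≤ -(z₀.re / 2) := by linarith
        exact mul_le_mul_of_nonneg_left (Real.exp_le_exp.2 (mul_le_mul_of_nonneg_right h3 ht.le))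
          (by positivity)
  have hright : DifferentiableOn ℂ (fun z : ℂ =>
      (Real.Gamma (K + 1) : ℂ) / z ^ ((K + 1 : ℝ) : ℂ)) rightHalfPlane := by
    intro z hz
    have hz : 0 < z.re := hz
    have hz0 : z ≠ 0 := fun h => by simp [h] at hz
    refine DifferentiableAt.differentiableWithinAt ?_
    refine (differentiableAt_const _).div (differentiableAt_id.cpow_const (Or.inl hz)) ?_
    exact (Complex.cpow_ne_zero_iff_of_exponent_ne_zero
      (Complex.ofReal_ne_zero.2 (by linarith))).2 hz0
  -- Both sides are holomorphic and agree on the positive real axis, which accumulates at `1`.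
  refine (hleft.analyticOnNhd isOpen_rightHalfPlane).eqOn_of_preconnected_of_frequently_eq
    (hright.analyticOnNhd isOpen_rightHalfPlane) convex_rightHalfPlane.isPreconnected
    (z₀ := ((1 : ℝ) : ℂ)) (by simp [rightHalfPlane]) ?_ hz
  have htend : Tendsto (fun x : ℝ => (x : ℂ)) (𝓝[≠] 1) (𝓝[≠] ((1 : ℝ) : ℂ)) :=
    Complex.continuous_ofReal.continuousWithinAt.tendsto_nhdsWithin
      fun x hx => by simpa using hx
  refine htend.frequently (Eventually.frequently ?_)
  filter_upwards [mem_nhdsWithin_of_mem_nhds (lt_mem_nhds (zero_lt_one (α := ℝ)))] with x hx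
  have hreal := Real.integral_rpow_mul_exp_neg_mul_Ioi (a := K + 1) (r := x) (by linarith) hx
  rw [add_sub_cancel_right] at hreal
  have hcast : ∫ t in Set.Ioi (0 : ℝ), ((t ^ K : ℝ) : ℂ) * Complex.exp (-(x : ℂ) * t) =
      ((∫ t in Set.Ioi (0 : ℝ), t ^ K * Real.exp (-(x * t)) : ℝ) : ℂ) := by
    rw [← integral_complex_ofReal]
    congr 1
    funext t
    push_cast
    simp
  rw [hcast, hreal, one_div, Real.inv_rpow hx.le, ← Complex.ofReal_cpow hx.le]
  push_cast
  field_simp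

theorem truncPow_eq_max_rpow {K : ℝ} (hK : 0 < K) (y : ℝ) : truncPow K y = max y 0 ^ K := by
  rcases le_or_gt y 0 with hy | hy
  · rw [truncPow_of_nonpos hy, max_eq_right hy, Real.zero_rpow hK.ne']
  · rw [truncPow_of_pos hy, max_eq_left hy.le]

theorem continuous_truncPow {K : ℝ} (hK : 0 < K) : Continuous (truncPow K) := by
  rw [funext (truncPow_eq_max_rpow hK)]
  exact (continuous_id.max continuous_const).rpow_const fun _ => Or.inr hK.le

/-! ### Vertical lines and Perron's formula for one exponential -/

/-- The point `c + i t` of the vertical line of abscissa `c`. -/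
noncomputable def vline (c t : ℝ) : ℂ := (c : ℂ) + t * Complex.I

@[simp]
theorem vline_re (c t : ℝ) : (vline c t).re = c := by simp [vline]

@[simp]
theorem vline_im (c t : ℝ) : (vline c t).im = t := by simp [vline]

theorem continuous_vline (c : ℝ) : Continuous (vline c) := by
  unfold vline
  fun_prop

theorem vline_ne_zero {c : ℝ} (hc : 0 < c) (t : ℝ) : vline c t ≠ 0 := fun h => by
  have := congrArg Complex.re h
  simp [hc.ne'] at this

theorem le_norm_vline (c t : ℝ) : c ≤ ‖vline c t‖ := by
  simpa using Complex.re_le_norm (vline c t)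

theorem continuous_vline_cpow {c : ℝ} (hc : 0 < c) (r : ℂ) :
    Continuous fun t => vline c t ^ r :=
  (continuous_vline c).cpow continuous_const fun t => Or.inl (by simpa using hc)

theorem vline_cpow_ne_zero {c : ℝ} (hc : 0 < c) (t : ℝ) (r : ℂ) : vline c t ^ r ≠ 0 := by
  rw [Complex.cpow_def_of_ne_zero (vline_ne_zero hc t)]
  exact Complex.exp_ne_zero _

/-- Since `‖z‖ ≥ c` on the line, `1 + ‖z‖` may be traded for a multiple of `‖z‖`, which scales well
when `c = 1 / x`. -/
theorem one_add_norm_vline_le {c : ℝ} (hc : 0 < c) (t : ℝ) :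
    1 + ‖vline c t‖ ≤ (1 / c + 1) * ‖vline c t‖ := by
  have h : 1 ≤ 1 / c * ‖vline c t‖ := by
    rw [one_div, ← div_eq_inv_mul]
    exact (one_le_div hc).2 (le_norm_vline c t)
  linarith

theorem integrable_norm_vline_rpow_neg {c r : ℝ} (hc : 0 < c) (hr : 1 < r) :
    MeasureTheory.Integrable fun t : ℝ => ‖vline c t‖ ^ (-r) := by
  have hj : MeasureTheory.Integrable fun t : ℝ => (1 + ‖t‖) ^ (-r) :=
    integrable_one_add_norm (by simpa using hr)
  refine (hj.const_mul ((1 / c + 1) ^ r)).mono' ?_ (Eventually.of_forall fun t => ?_)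
  · exact (((continuous_vline c).norm.rpow_const fun t =>
      Or.inl (norm_ne_zero_iff.2 (vline_ne_zero hc t)))).aestronglyMeasurable
  · have hpos : 0 < ‖vline c t‖ := norm_pos_iff.2 (vline_ne_zero hc t)
    have h1 : 1 + ‖t‖ ≤ (1 / c + 1) * ‖vline c t‖ := by
      have h2 : |t| ≤ ‖vline c t‖ := by simpa using Complex.abs_im_le_norm (vline c t)
      rw [Real.norm_eq_abs]
      linarith [one_add_norm_vline_le hc t]
    have h0 : 0 < 1 + ‖t‖ := by positivity
    rw [Real.norm_of_nonneg (by positivity), Real.rpow_neg hpos.le, Real.rpow_neg h0.le,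
      ← div_eq_mul_inv, inv_eq_one_div, div_le_div_iff₀ (by positivity) (by positivity), one_mul,
      ← Real.mul_rpow (by positivity) hpos.le]
    exact Real.rpow_le_rpow h0.le h1 (by linarith)

/-- Perron's formula for a single exponential. -/
theorem integral_cexp_mul_vline_div_cpow {K c : ℝ} (hK : 0 < K) (hc : 0 < c) (y : ℝ) :
    ∫ t : ℝ, Complex.exp (y * vline c t) / vline c t ^ ((K + 1 : ℝ) : ℂ) =
      (2 * Real.pi / Real.Gamma (K + 1) * truncPow K y : ℝ) := by
  -- Damping by `exp (-c * y)` makes the truncated power integrable. Its Fourier transform is a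
  -- multiple of `z ^ (-(K + 1))` on the line, integrable as `K > 0`, so Fourier inversion yields
  -- the formula.
  set h : ℝ → ℂ := fun y => ((truncPow K y * Real.exp (-c * y) : ℝ) : ℂ) with hh
  have hcont : Continuous h :=
    Complex.continuous_ofReal.comp ((continuous_truncPow hK).mul (by fun_prop))
  have hind : ∀ g : ℝ → ℂ, (fun y => (truncPow K y : ℂ) * g y) =
      (Set.Ioi (0 : ℝ)).indicator fun y => ((y ^ K : ℝ) : ℂ) * g y := by
    intro g
    funext y
    by_cases hy : 0 < y
    · rw [Set.indicator_of_mem (Set.mem_Ioi.2 hy), truncPow_of_pos hy]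
    · rw [Set.indicator_of_notMem (by simpa using hy), truncPow_of_nonpos (not_lt.1 hy)]
      simp
  have hint : MeasureTheory.Integrable h := by
    have h1 : h = (Set.Ioi (0 : ℝ)).indicator
        fun y => ((y ^ K : ℝ) : ℂ) * ((Real.exp (-c * y) : ℝ) : ℂ) := by
      rw [← hind]
      funext y
      simp [hh]
    rw [h1, MeasureTheory.integrable_indicator_iff measurableSet_Ioi]
    have h2 := integrableOn_rpow_mul_exp_neg_mul_rpow (p := 1) (s := K) (b := c)
      (by linarith) one_pos hc
    simp only [Real.rpow_one] at h2
    have h3 := h2.ofReal (𝕜 := ℂ)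
    refine h3.congr (Eventually.of_forall fun t => ?_)
    simp
  have hfour : ∀ ξ : ℝ, FourierTransform.fourier h ξ =
      (Real.Gamma (K + 1) : ℂ) / vline c (2 * Real.pi * ξ) ^ ((K + 1 : ℝ) : ℂ) := by
    intro ξ
    rw [Real.fourier_real_eq_integral_exp_smul,
      ← integral_rpow_mul_cexp_neg_mul_Ioi hK (by simpa using hc),
      ← MeasureTheory.integral_indicator measurableSet_Ioi, ← hind]
    congr 1
    funext v
    simp only [hh, smul_eq_mul, vline]
    push_cast
    rw [mul_left_comm, ← Complex.exp_add]
    congr 2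
    ring
  have hKint : MeasureTheory.Integrable fun t : ℝ =>
      (Real.Gamma (K + 1) : ℂ) / vline c t ^ ((K + 1 : ℝ) : ℂ) := by
    refine ((integrable_norm_vline_rpow_neg hc (r := K + 1) (by linarith)).const_mul
      ‖(Real.Gamma (K + 1) : ℂ)‖).mono' ?_ (Eventually.of_forall fun t => ?_)
    · exact (continuous_const.div (continuous_vline_cpow hc _)
        fun t => vline_cpow_ne_zero hc t _).aestronglyMeasurable
    · rw [norm_div, Complex.norm_cpow_real, Real.rpow_neg (norm_nonneg _), div_eq_mul_inv]
  have hfint : MeasureTheory.Integrable (FourierTransform.fourier h) := by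
    rw [funext hfour]
    exact hKint.comp_mul_left' (by positivity)
  have hinv := hint.fourierInv_fourier_eq hfint (v := y) hcont.continuousAt
  rw [Real.fourierInv_eq', funext hfour] at hinv
  set G : ℝ → ℂ := fun t => Complex.exp (t * y * Complex.I) *
    ((Real.Gamma (K + 1) : ℂ) / vline c t ^ ((K + 1 : ℝ) : ℂ)) with hG
  have hGint : ∫ ξ : ℝ, G (2 * Real.pi * ξ) = h y := by
    rw [← hinv]
    congr 1
    funext ξ
    simp only [hG, smul_eq_mul]
    congr 2
    simp
    ring
  rw [MeasureTheory.Measure.integral_comp_mul_left, abs_of_pos (by positivity)] at hGint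
  have hΓ : (Real.Gamma (K + 1) : ℂ) ≠ 0 :=
    Complex.ofReal_ne_zero.2 (Real.Gamma_pos_of_pos (by linarith)).ne'
  have hfin : ∫ t : ℝ, Complex.exp (y * vline c t) / vline c t ^ ((K + 1 : ℝ) : ℂ) =
      Complex.exp (c * y) / (Real.Gamma (K + 1) : ℂ) * ∫ t, G t := by
    rw [← MeasureTheory.integral_const_mul]
    congr 1
    funext t
    simp only [hG]
    rw [show (y : ℂ) * vline c t = c * y + t * y * Complex.I by unfold vline; ring,
      Complex.exp_add]
    field_simp
  rw [Complex.real_smul] at hGint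
  have hG2 : ∫ t, G t = 2 * Real.pi * h y := by
    rw [← hGint, ← mul_assoc]
    push_cast
    have : (Real.pi : ℂ) ≠ 0 := Complex.ofReal_ne_zero.2 Real.pi_ne_zero
    field_simp
  rw [hfin, hG2]
  simp only [hh]
  push_cast
  rw [neg_mul, Complex.exp_neg]
  field_simp

/-! ### Perron's formula at high order -/

/-- The kernel `e ^ (x z) / z ^ (K + 1)` of Perron's formula at the point `z = c + i t`. -/
noncomputable def perronKernel (K c x t : ℝ) : ℂ :=
  Complex.exp (x * vline c t) / vline c t ^ ((K + 1 : ℝ) : ℂ)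

/-- The integral in Perron's formula of order `K`, along the vertical line of abscissa `c`. -/
noncomputable def perronIntegral (f : ℂ → ℂ) (K c : ℝ) (s : ℂ) (x : ℝ) : ℂ :=
  ∫ t : ℝ, f (s + vline c t) * perronKernel K c x t

theorem continuous_perronKernel (K : ℝ) {c : ℝ} (hc : 0 < c) (x : ℝ) :
    Continuous (perronKernel K c x) :=
  (continuous_const.mul (continuous_vline c)).cexp.div (continuous_vline_cpow hc _)
    fun t => vline_cpow_ne_zero hc t _

theorem norm_perronKernel (K c x t : ℝ) :
    ‖perronKernel K c x t‖ = Real.exp (c * x) * ‖vline c t‖ ^ (-(K + 1)) := by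
  rw [perronKernel, norm_div, Complex.norm_cpow_real, Complex.norm_exp,
    Real.rpow_neg (norm_nonneg _), div_eq_mul_inv]
  simp [mul_comm]

theorem vline_mul_perronKernel (K : ℝ) {c : ℝ} (hc : 0 < c) (x t : ℝ) :
    vline c t * perronKernel (K + 1) c x t = perronKernel K c x t := by
  have h0 := vline_ne_zero hc t
  have h1 := vline_cpow_ne_zero hc t ((K + 1 : ℝ) : ℂ)
  rw [perronKernel, perronKernel,
    show (((K + 1 + 1 : ℝ)) : ℂ) = ((K + 1 : ℝ) : ℂ) + 1 by push_cast; ring,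
    Complex.cpow_add _ _ h0, Complex.cpow_one]
  field_simp

/-- Differentiating `exp (x * z)` brings down a factor `z`, which lowers the order by one. -/
theorem hasDerivAt_perronKernel (K : ℝ) {c : ℝ} (hc : 0 < c) (x t : ℝ) :
    HasDerivAt (fun x => perronKernel (K + 1) c x t) (perronKernel K c x t) x := by
  have h : HasDerivAt (fun x : ℝ => (x : ℂ) * vline c t) (vline c t) x := by
    simpa using (Complex.ofRealCLM.hasDerivAt (x := x)).mul_const (vline c t)
  rw [← vline_mul_perronKernel K hc]
  convert! h.cexp.div_const (vline c t ^ ((K + 1 + 1 : ℝ) : ℂ)) using 1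
  rw [perronKernel]
  ring

theorem integrable_perronKernel {K c : ℝ} (hK : 0 < K) (hc : 0 < c) (x : ℝ) :
    MeasureTheory.Integrable (perronKernel K c x) := by
  refine ((integrable_norm_vline_rpow_neg hc (r := K + 1) (by linarith)).const_mul
    (Real.exp (c * x))).mono' (continuous_perronKernel K hc x).aestronglyMeasurable
    (Eventually.of_forall fun t => ?_)
  rw [norm_perronKernel]

theorem cexp_mul_perronKernel (K c x t lam : ℝ) :
    Complex.exp (-(lam : ℂ) * vline c t) * perronKernel K c x t =
      perronKernel K c (x - lam) t := by
  rw [perronKernel, perronKernel, ← mul_div_assoc, ← Complex.exp_add]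
  congr 2
  push_cast
  ring

theorem tendsto_truncPow_one_sub_div (m y : ℝ) :
    Tendsto (fun x : ℝ => truncPow m (1 - y / x)) atTop (𝓝 1) := by
  have h1 : Tendsto (fun x : ℝ => 1 - y / x) atTop (𝓝 1) := by
    simpa using (tendsto_const_nhds (x := y)).div_atTop tendsto_id |>.const_sub (1 : ℝ)
  have h2 : Tendsto (fun x : ℝ => (1 - y / x) ^ m) atTop (𝓝 1) := by
    have := h1.rpow_const (p := m) (Or.inl one_ne_zero)
    rwa [Real.one_rpow] at this
  refine h2.congr' ?_
  filter_upwards [h1.eventually (lt_mem_nhds zero_lt_one)] with x hx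
  rw [truncPow_of_pos hx]

/-- Perron's formula for a Riesz mean. -/
theorem IsFrequency.perronIntegral_rieszMean {lam : ℕ → ℝ} (h : IsFrequency lam) {m K c : ℝ}
    (hK : 0 < K) (hc : 0 < c) (a : ℕ → ℂ) (s : ℂ) {x X Y : ℝ} (hX : x ≤ X) (hXY : X ≤ Y)
    (hY : 0 < Y) :
    perronIntegral (rieszMean lam m a Y) K c s x =
      (2 * Real.pi / Real.Gamma (K + 1) : ℝ) *
        ∑ n ∈ h.below X, a n * Complex.exp (-(lam n : ℂ) * s) * (truncPow K (x - lam n) : ℂ) *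
          (truncPow m (1 - lam n / Y) : ℂ) := by
  have hsub : h.below X ⊆ h.below Y := fun n hn =>
    h.mem_below.2 ((h.mem_below.1 hn).trans_le hXY)
  rw [Finset.sum_subset hsub, perronIntegral]
  · have hpt : ∀ t : ℝ, rieszMean lam m a Y (s + vline c t) * perronKernel K c x t =
        ∑ n ∈ h.below Y, a n * Complex.exp (-(lam n : ℂ) * s) *
          (truncPow m (1 - lam n / Y) : ℂ) * perronKernel K c (x - lam n) t := by
      intro t
      rw [h.rieszMean_eq_sum_below hY le_rfl, Finset.sum_mul]
      refine Finset.sum_congr rfl fun n _ => ?_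
      rw [← cexp_mul_perronKernel, mul_add, Complex.exp_add]
      ring
    simp_rw [hpt]
    rw [MeasureTheory.integral_finsetSum _ fun n _ =>
      (integrable_perronKernel hK hc _).const_mul _, Finset.mul_sum]
    refine Finset.sum_congr rfl fun n _ => ?_
    rw [MeasureTheory.integral_const_mul,
      show ∫ t, perronKernel K c (x - lam n) t = _ from
        integral_cexp_mul_vline_div_cpow hK hc (x - lam n)]
    push_cast
    ring
  · intro n _ hn
    have : X ≤ lam n := not_lt.1 fun hlt => hn (h.mem_below.2 hlt)
    rw [truncPow_of_nonpos (by linarith)]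
    simp

/-- Perron's formula of high order for the limit of Riesz means of integral order. -/
theorem IsFrequency.perronIntegral_eq_of_tendsto {lam : ℕ → ℝ} (h : IsFrequency lam) (M : ℕ)
    {K c : ℝ} (hK : M + 1 < K) (hc : 0 < c) {a : ℕ → ℂ} {f : ℂ → ℂ} {s : ℂ}
    (hlim : ∀ z : ℂ, 0 ≤ z.re →
      Tendsto (fun x : ℝ => rieszMean lam M a x (s + z)) atTop (𝓝 (f (s + z))))
    {x X : ℝ} (hX : x ≤ X) :
    perronIntegral f K c s x = (2 * Real.pi / Real.Gamma (K + 1) : ℝ) *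
      ∑ n ∈ h.below X, a n * Complex.exp (-(lam n : ℂ) * s) * (truncPow K (x - lam n) : ℂ) := by
  have hM0 : (0 : ℝ) ≤ M := M.cast_nonneg
  have hK0 : 0 < K := by linarith
  -- The case `z = 0` of `hlim` gives bounded means at `s` itself, the input for partial summation.
  obtain ⟨A, hA0, hA⟩ := h.rieszMean_bounded_of_tendsto hM0 (by simpa using hlim 0 le_rfl)
  obtain ⟨C, hC0, hC⟩ := h.exists_norm_rieszMean_add_le M hA0 hA hc
  refine tendsto_nhds_unique (f := fun Y : ℝ => perronIntegral (rieszMean lam M a Y) K c s x)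
    (l := atTop) ?_ ?_
  · refine MeasureTheory.tendsto_integral_filter_of_dominated_convergence
      -- Growth of order `M + 1` against decay of order `K + 1` leaves the exponent `K - M`, which
      -- exceeds `1`.
      (fun t => C * (1 / c + 1) ^ (M + 1) * Real.exp (c * x) * ‖vline c t‖ ^ (-(K - M)))
      ?_ ?_ ((integrable_norm_vline_rpow_neg hc (by linarith)).const_mul _) ?_
    · filter_upwards [eventually_gt_atTop 0] with Y hY
      have hcont : Continuous fun t : ℝ => rieszMean lam M a Y (s + vline c t) := by
        have := continuous_vline c
        simp_rw [h.rieszMean_eq_sum_below hY le_rfl]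
        fun_prop
      exact (hcont.mul (continuous_perronKernel K hc x)).aestronglyMeasurable
    · filter_upwards [eventually_ge_atTop 1] with Y hY
      refine Eventually.of_forall fun t => ?_
      have hpos : 0 < ‖vline c t‖ := norm_pos_iff.2 (vline_ne_zero hc t)
      rw [norm_mul, norm_perronKernel]
      calc _ ≤ C * ((1 / c + 1) * ‖vline c t‖) ^ (M + 1) *
            (Real.exp (c * x) * ‖vline c t‖ ^ (-(K + 1))) := by
            gcongr
            refine (hC _ (vline_re c t) Y hY).trans ?_
            gcongr
            exact one_add_norm_vline_le hc t
        _ = C * (1 / c + 1) ^ (M + 1) * Real.exp (c * x) *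
            (‖vline c t‖ ^ ((M + 1 : ℕ) : ℝ) * ‖vline c t‖ ^ (-(K + 1))) := by
            rw [Real.rpow_natCast, mul_pow]
            ring
        _ = _ := by
            rw [← Real.rpow_add hpos]
            congr 2
            push_cast
            ring
    · refine Eventually.of_forall fun t => ?_
      exact (hlim _ (by simpa using hc.le)).mul_const _
  · have : Tendsto (fun Y : ℝ => (2 * Real.pi / Real.Gamma (K + 1) : ℝ) *
        ∑ n ∈ h.below X, a n * Complex.exp (-(lam n : ℂ) * s) * (truncPow K (x - lam n) : ℂ) *
          (truncPow M (1 - lam n / Y) : ℂ)) atTop (𝓝 ((2 * Real.pi / Real.Gamma (K + 1) : ℝ) *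
      ∑ n ∈ h.below X, a n * Complex.exp (-(lam n : ℂ) * s) * (truncPow K (x - lam n) : ℂ) *
        ((1 : ℝ) : ℂ))) := by
      refine Tendsto.const_mul _ (tendsto_finsetSum _ fun n _ => Tendsto.const_mul _ ?_)
      exact (Complex.continuous_ofReal.tendsto 1).comp (tendsto_truncPow_one_sub_div M (lam n))
    simp only [Complex.ofReal_one, mul_one] at this
    refine this.congr' ?_
    filter_upwards [eventually_gt_atTop 0, eventually_ge_atTop X] with Y hY hXY
    rw [h.perronIntegral_rieszMean hK0 hc a s hX hXY hY]

/-! ### Lowering the order and continuation to the half-plane -/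

/-- Pointwise form of the bound `‖f‖_{∞,ℓ} ≤ A` on the right half-plane. -/
def HasGrowthBound (l A : ℝ) (f : ℂ → ℂ) : Prop :=
  ∀ s ∈ rightHalfPlane, ‖f s‖ ≤ A * (1 + ‖s‖) ^ l

/-- The inequality `1 + ‖s + z‖ ≤ (1 + ‖s‖) * (1 + ‖z‖)` separates the growth in `s` from the
integration variable, leaving a pure power of `‖z‖`. -/
theorem HasGrowthBound.norm_mul_perronKernel_le {l A : ℝ} {f : ℂ → ℂ} (hf : HasGrowthBound l A f)
    (hA : 0 ≤ A) (hl : 0 ≤ l) (K : ℝ) {c : ℝ} (hc : 0 < c) {s : ℂ} (hs : s ∈ rightHalfPlane)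
    (x t : ℝ) :
    ‖f (s + vline c t) * perronKernel K c x t‖ ≤
      A * (1 + ‖s‖) ^ l * (1 / c + 1) ^ l * Real.exp (c * x) * ‖vline c t‖ ^ (-(K + 1 - l)) := by
  have hs : 0 < s.re := hs
  have hpos : 0 < ‖vline c t‖ := norm_pos_iff.2 (vline_ne_zero hc t)
  have hmem : s + vline c t ∈ rightHalfPlane := by
    change 0 < (s + vline c t).re
    rw [Complex.add_re, vline_re]
    linarith
  have h1 : 1 + ‖s + vline c t‖ ≤ (1 + ‖s‖) * ((1 / c + 1) * ‖vline c t‖) :=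
    calc 1 + ‖s + vline c t‖ ≤ (1 + ‖s‖) * (1 + ‖vline c t‖) := by
          nlinarith [norm_add_le s (vline c t), norm_nonneg s, norm_nonneg (vline c t)]
      _ ≤ _ := mul_le_mul_of_nonneg_left (one_add_norm_vline_le hc t) (by positivity)
  rw [norm_mul, norm_perronKernel]
  calc _ ≤ A * ((1 + ‖s‖) * ((1 / c + 1) * ‖vline c t‖)) ^ l *
        (Real.exp (c * x) * ‖vline c t‖ ^ (-(K + 1))) := by
        gcongr
        refine (hf _ hmem).trans ?_
        gcongr
    _ = A * (1 + ‖s‖) ^ l * (1 / c + 1) ^ l * Real.exp (c * x) *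
        (‖vline c t‖ ^ l * ‖vline c t‖ ^ (-(K + 1))) := by
        rw [Real.mul_rpow (by positivity) (by positivity), Real.mul_rpow (by positivity) hpos.le]
        ring
    _ = _ := by
        rw [← Real.rpow_add hpos]
        congr 2
        ring

theorem continuous_comp_add_vline {f : ℂ → ℂ} (hd : DifferentiableOn ℂ f rightHalfPlane) {c : ℝ}
    (hc : 0 < c) {s : ℂ} (hs : s ∈ rightHalfPlane) : Continuous fun t => f (s + vline c t) := by
  refine hd.continuousOn.comp_continuous (continuous_const.add (continuous_vline c)) fun t => ?_
  have hs : 0 < s.re := hs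
  change 0 < (s + vline c t).re
  rw [Complex.add_re, vline_re]
  linarith

theorem HasGrowthBound.integrable_mul_perronKernel {l A : ℝ} {f : ℂ → ℂ}
    (hf : HasGrowthBound l A f) (hA : 0 ≤ A) (hl : 0 ≤ l)
    (hd : DifferentiableOn ℂ f rightHalfPlane) {K : ℝ} (hK : l < K) {c : ℝ} (hc : 0 < c) {s : ℂ}
    (hs : s ∈ rightHalfPlane) (x : ℝ) :
    MeasureTheory.Integrable fun t => f (s + vline c t) * perronKernel K c x t :=
  ((integrable_norm_vline_rpow_neg hc (by linarith)).const_mul _).mono'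
    ((continuous_comp_add_vline hd hc hs).mul
      (continuous_perronKernel K hc x)).aestronglyMeasurable
    (Eventually.of_forall fun t => hf.norm_mul_perronKernel_le hA hl K hc hs x t)

theorem HasGrowthBound.hasDerivAt_perronIntegral {l A : ℝ} {f : ℂ → ℂ}
    (hf : HasGrowthBound l A f) (hA : 0 ≤ A) (hl : 0 ≤ l)
    (hd : DifferentiableOn ℂ f rightHalfPlane) {K : ℝ} (hK : l < K) {c : ℝ} (hc : 0 < c) {s : ℂ}
    (hs : s ∈ rightHalfPlane) (x : ℝ) :
    HasDerivAt (perronIntegral f (K + 1) c s) (perronIntegral f K c s x) x := by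
  refine (hasDerivAt_integral_of_dominated_loc_of_deriv_le
    (F := fun x t => f (s + vline c t) * perronKernel (K + 1) c x t)
    (F' := fun x t => f (s + vline c t) * perronKernel K c x t) (s := Metric.ball x 1)
    (bound := fun t => A * (1 + ‖s‖) ^ l * (1 / c + 1) ^ l * Real.exp (c * (x + 1)) *
      ‖vline c t‖ ^ (-(K + 1 - l)))
    (Metric.ball_mem_nhds x one_pos) ?_ ?_ ?_ ?_ ?_ ?_).2
  · exact Eventually.of_forall fun y => (hf.integrable_mul_perronKernel hA hl hd
      (by linarith) hc hs y).aestronglyMeasurable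
  · exact hf.integrable_mul_perronKernel hA hl hd (by linarith) hc hs x
  · exact (hf.integrable_mul_perronKernel hA hl hd hK hc hs x).aestronglyMeasurable
  · refine Eventually.of_forall fun t y hy => ?_
    refine (hf.norm_mul_perronKernel_le hA hl K hc hs y t).trans ?_
    rw [Metric.mem_ball, Real.dist_eq] at hy
    have : y ≤ x + 1 := by linarith [(abs_lt.1 hy).2]
    gcongr
  · exact (integrable_norm_vline_rpow_neg hc (by linarith)).const_mul _
  · exact Eventually.of_forall fun t y _ => (hasDerivAt_perronKernel K hc y t).const_mul _

theorem hasDerivAt_truncPow {K : ℝ} (hK : 0 < K) (y : ℝ) :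
    HasDerivAt (truncPow (K + 1)) ((K + 1) * truncPow K y) y := by
  have hne : ∀ y : ℝ, y ≠ 0 → HasDerivAt (truncPow (K + 1)) ((K + 1) * truncPow K y) y := by
    intro y hy
    rcases lt_or_gt_of_ne hy with hy | hy
    · rw [truncPow_of_nonpos hy.le, mul_zero]
      refine (hasDerivAt_const y (0 : ℝ)).congr_of_eventuallyEq ?_
      filter_upwards [gt_mem_nhds hy] with u hu using truncPow_of_nonpos hu.le
    · have := Real.hasDerivAt_rpow_const (x := y) (p := K + 1) (Or.inl hy.ne')
      rw [add_sub_cancel_right] at this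
      rw [truncPow_of_pos hy]
      refine this.congr_of_eventuallyEq ?_
      filter_upwards [lt_mem_nhds hy] with u hu using truncPow_of_pos hu
  rcases eq_or_ne y 0 with rfl | hy
  -- At the corner the derivative is found as the limit of nearby derivatives, which is continuous
  -- there because `K > 0`.
  · exact hasDerivAt_of_hasDerivAt_of_ne (x := (0 : ℝ)) hne
      (continuous_truncPow (by linarith)).continuousAt
      (continuous_const.mul (continuous_truncPow hK)).continuousAt
  · exact hne y hy

/-- Perron's formula of order `K + 1` implies that of order `K`, by differentiation in `x`. -/
theorem IsFrequency.perronIntegral_eq_of_succ {lam : ℕ → ℝ} (h : IsFrequency lam) {l A : ℝ}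
    {f : ℂ → ℂ} (hf : HasGrowthBound l A f) (hA : 0 ≤ A) (hl : 0 ≤ l)
    (hd : DifferentiableOn ℂ f rightHalfPlane) {K : ℝ} (hK : l < K) {c : ℝ} (hc : 0 < c) {s : ℂ}
    (hs : s ∈ rightHalfPlane) {a : ℕ → ℂ}
    (hsucc : ∀ x X : ℝ, x ≤ X → perronIntegral f (K + 1) c s x =
      (2 * Real.pi / Real.Gamma (K + 1 + 1) : ℝ) * ∑ n ∈ h.below X,
        a n * Complex.exp (-(lam n : ℂ) * s) * (truncPow (K + 1) (x - lam n) : ℂ))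
    (x X : ℝ) (hX : x ≤ X) :
    perronIntegral f K c s x = (2 * Real.pi / Real.Gamma (K + 1) : ℝ) *
      ∑ n ∈ h.below X, a n * Complex.exp (-(lam n : ℂ) * s) * (truncPow K (x - lam n) : ℂ) := by
  have hK0 : 0 < K := by linarith
  have hsum : HasDerivAt (fun y : ℝ => (2 * Real.pi / Real.Gamma (K + 1 + 1) : ℝ) *
      ∑ n ∈ h.below (X + 1),
        a n * Complex.exp (-(lam n : ℂ) * s) * (truncPow (K + 1) (y - lam n) : ℂ))
      ((2 * Real.pi / Real.Gamma (K + 1 + 1) : ℝ) * ∑ n ∈ h.below (X + 1),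
        a n * Complex.exp (-(lam n : ℂ) * s) * (((K + 1) * truncPow K (x - lam n) : ℝ) : ℂ)) x := by
    refine HasDerivAt.const_mul _ (HasDerivAt.fun_sum fun n _ => HasDerivAt.const_mul _ ?_)
    exact ((hasDerivAt_truncPow hK0 (x - lam n)).comp_sub_const x (lam n)).ofReal_comp
  -- Differentiation needs one index set valid for all `y` near `x`; `X + 1` leaves the room.
  have hev : perronIntegral f (K + 1) c s =ᶠ[𝓝 x] fun y : ℝ =>
      (2 * Real.pi / Real.Gamma (K + 1 + 1) : ℝ) * ∑ n ∈ h.below (X + 1),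
        a n * Complex.exp (-(lam n : ℂ) * s) * (truncPow (K + 1) (y - lam n) : ℂ) := by
    filter_upwards [gt_mem_nhds (show x < X + 1 by linarith)] with y hy using hsucc y _ hy.le
  have hsub : h.below X ⊆ h.below (X + 1) := fun n hn =>
    h.mem_below.2 ((h.mem_below.1 hn).trans (lt_add_one X))
  rw [(hf.hasDerivAt_perronIntegral hA hl hd hK hc hs x).unique (hsum.congr_of_eventuallyEq hev),
    Finset.sum_subset hsub, Finset.mul_sum, Finset.mul_sum]
  · refine Finset.sum_congr rfl fun n _ => ?_
    have hΓ : (Real.Gamma (K + 1) : ℂ) ≠ 0 :=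
      Complex.ofReal_ne_zero.2 (Real.Gamma_pos_of_pos (by linarith)).ne'
    have hK1 : ((K + 1 : ℝ) : ℂ) ≠ 0 := Complex.ofReal_ne_zero.2 (by linarith)
    rw [Real.Gamma_add_one (by linarith : K + 1 ≠ 0)]
    push_cast at hK1 ⊢
    field_simp
  · intro n _ hn
    have : X ≤ lam n := not_lt.1 fun hlt => hn (h.mem_below.2 hlt)
    rw [truncPow_of_nonpos (by linarith)]
    simp

theorem HasGrowthBound.differentiableOn_perronIntegral {l A : ℝ} {f : ℂ → ℂ}
    (hf : HasGrowthBound l A f) (hA : 0 ≤ A) (hl : 0 ≤ l)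
    (hd : DifferentiableOn ℂ f rightHalfPlane) {K : ℝ} (hK : l < K) {c : ℝ} (hc : 0 < c) (x : ℝ) :
    DifferentiableOn ℂ (fun s => perronIntegral f K c s x) rightHalfPlane := by
  refine differentiableOn_integral_of_locally_dominated isOpen_rightHalfPlane
    (fun s hs => (hf.integrable_mul_perronKernel hA hl hd hK hc hs x).aestronglyMeasurable)
    (fun t => ?_) fun s₀ hs₀ => ?_
  · refine DifferentiableOn.mul_const (hd.comp (by fun_prop) fun s hs => ?_) _
    have hs : 0 < s.re := hs
    change 0 < (s + vline c t).re
    rw [Complex.add_re, vline_re]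
    linarith
  · obtain ⟨r, hr, hball⟩ := Metric.isOpen_iff.1 isOpen_rightHalfPlane s₀ hs₀
    refine ⟨r, hr, fun t => A * (1 + (‖s₀‖ + r)) ^ l * (1 / c + 1) ^ l * Real.exp (c * x) *
      ‖vline c t‖ ^ (-(K + 1 - l)),
      (integrable_norm_vline_rpow_neg hc (by linarith)).const_mul _,
      Eventually.of_forall fun t s hs => ?_⟩
    refine (hf.norm_mul_perronKernel_le hA hl K hc (hball hs) x t).trans ?_
    have : ‖s‖ ≤ ‖s₀‖ + r := by
      rw [Metric.mem_ball, dist_eq_norm] at hs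
      linarith [norm_le_norm_add_norm_sub' s s₀]
    beta_reduce
    gcongr

/-- Perron's formula for functions of polynomial growth with a Riesz germ. -/
theorem IsFrequency.perronIntegral_eq {lam : ℕ → ℝ} (h : IsFrequency lam) {l A : ℝ}
    {f : ℂ → ℂ} (hf : HasGrowthBound l A f) (hA : 0 ≤ A) (hl : 0 ≤ l)
    (hd : DifferentiableOn ℂ f rightHalfPlane) {a : ℕ → ℂ} (ha : IsRieszGerm lam a f)
    {k : ℝ} (hk : l < k) {c : ℝ} (hc : 0 < c) {s : ℂ} (hs : s ∈ rightHalfPlane) (x : ℝ) :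
    perronIntegral f k c s x = (2 * Real.pi / Real.Gamma (k + 1) : ℝ) *
      ∑ n ∈ h.below x, a n * Complex.exp (-(lam n : ℂ) * s) * (truncPow k (x - lam n) : ℂ) := by
  obtain ⟨m, hm, σ, hσ, hlim⟩ := ha
  have hfar : ∀ s : ℂ, σ < s.re → perronIntegral f k c s x =
      (2 * Real.pi / Real.Gamma (k + 1) : ℝ) * ∑ n ∈ h.below x,
        a n * Complex.exp (-(lam n : ℂ) * s) * (truncPow k (x - lam n) : ℂ) := by
    intro s hsσ
    have hs : s ∈ rightHalfPlane := hσ.trans_lt hsσ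
    -- Partial summation needs an integral order, and the consistency lemma a gap of at least `1`
    -- above `m`.
    set M : ℕ := ⌈m⌉₊ + 1
    have hM : m + 1 ≤ (M : ℝ) := by
      simp only [M]
      push_cast
      linarith [Nat.le_ceil m]
    -- `N` counts the differentiations in `x` separating `K` from the range `K > M + 1` already
    -- settled.
    have hdesc : ∀ N : ℕ, ∀ K : ℝ, l < K → M + 1 < K + N → ∀ x X : ℝ, x ≤ X →
        perronIntegral f K c s x = (2 * Real.pi / Real.Gamma (K + 1) : ℝ) *
          ∑ n ∈ h.below X,
            a n * Complex.exp (-(lam n : ℂ) * s) * (truncPow K (x - lam n) : ℂ) := by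
      intro N
      induction N with
      | zero =>
        intro K _ hKM x X hX
        refine h.perronIntegral_eq_of_tendsto M (by simpa using hKM) hc (fun z hz => ?_) hX
        refine h.tendsto_rieszMean_of_le hm hM (hlim _ ?_)
        rw [Complex.add_re]
        linarith
      | succ N ih =>
        intro K hK hKM
        refine h.perronIntegral_eq_of_succ hf hA hl hd hK hc hs (ih (K + 1) (by linarith) ?_)
        push_cast at hKM
        linarith
    refine hdesc (M + 2) k hk ?_ x x le_rfl
    push_cast
    linarith
  -- Identity theorem: the formula holds near `σ + 1`, hence on the whole half-plane.
  refine ((hf.differentiableOn_perronIntegral hA hl hd hk hc x).analyticOnNhd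
    isOpen_rightHalfPlane).eqOn_of_preconnected_of_eventuallyEq
    (g := fun s => (2 * Real.pi / Real.Gamma (k + 1) : ℝ) * ∑ n ∈ h.below x,
        a n * Complex.exp (-(lam n : ℂ) * s) * (truncPow k (x - lam n) : ℂ)) ?_
    convex_rightHalfPlane.isPreconnected (z₀ := ((σ + 1 : ℝ) : ℂ)) ?_ ?_ hs
  · exact DifferentiableOn.analyticOnNhd (by fun_prop) isOpen_rightHalfPlane
  · change 0 < ((σ + 1 : ℝ) : ℂ).re
    rw [Complex.ofReal_re]
    linarith
  · filter_upwards [(isOpen_lt continuous_const Complex.continuous_re).mem_nhds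
      (show σ < ((σ + 1 : ℝ) : ℂ).re by simp)] with w hw using hfar w hw

/-! ### Uniform bounds from the line of abscissa `1 / x` -/

theorem vline_inv {x : ℝ} (hx : 0 < x) (t : ℝ) : vline (1 / x) t = (x : ℂ)⁻¹ * vline 1 (x * t) := by
  have : (x : ℂ) ≠ 0 := Complex.ofReal_ne_zero.2 hx.ne'
  unfold vline
  push_cast
  field_simp

theorem integral_norm_vline_inv_rpow_neg {x : ℝ} (hx : 0 < x) (r : ℝ) :
    ∫ t : ℝ, ‖vline (1 / x) t‖ ^ (-r) = x ^ (r - 1) * ∫ t : ℝ, ‖vline 1 t‖ ^ (-r) := by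
  have hpt : ∀ t : ℝ, ‖vline (1 / x) t‖ ^ (-r) = x ^ r * ‖vline 1 (x * t)‖ ^ (-r) := by
    intro t
    rw [vline_inv hx, norm_mul, norm_inv, Complex.norm_real, Real.norm_of_nonneg hx.le,
      Real.mul_rpow (by positivity) (norm_nonneg _), Real.inv_rpow hx.le, Real.rpow_neg hx.le,
      inv_inv]
  simp_rw [hpt]
  rw [MeasureTheory.integral_const_mul,
    MeasureTheory.Measure.integral_comp_mul_left (fun t => ‖vline 1 t‖ ^ (-r)),
    abs_of_pos (by positivity), smul_eq_mul, ← mul_assoc, Real.rpow_sub_one hx.ne',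
    div_eq_mul_inv]

/-- Riesz means of order `k > l` inherit growth of order `l`, uniformly for `x` bounded away from
`0`. -/
theorem IsFrequency.norm_rieszMean_le_of_le {lam : ℕ → ℝ} (h : IsFrequency lam) {l A : ℝ}
    {f : ℂ → ℂ} (hf : HasGrowthBound l A f) (hA : 0 ≤ A) (hl : 0 ≤ l)
    (hd : DifferentiableOn ℂ f rightHalfPlane) {a : ℕ → ℂ} (ha : IsRieszGerm lam a f)
    {k : ℝ} (hk : l < k) {x₀ x : ℝ} (hx₀ : 0 < x₀) (hx : x₀ ≤ x) {s : ℂ}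
    (hs : s ∈ rightHalfPlane) :
    ‖rieszMean lam k a x s‖ ≤ Real.Gamma (k + 1) / (2 * Real.pi) * (1 / x₀ + 1) ^ l * Real.exp 1 *
      (∫ t : ℝ, ‖vline 1 t‖ ^ (-(k + 1 - l))) * A * (1 + ‖s‖) ^ l := by
  have hx0 : 0 < x := hx₀.trans_le hx
  have hΓ : 0 < Real.Gamma (k + 1) := Real.Gamma_pos_of_pos (by linarith)
  set J := ∫ t : ℝ, ‖vline 1 t‖ ^ (-(k + 1 - l))
  have hJ : 0 ≤ J := MeasureTheory.integral_nonneg fun t => by positivity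
  have hmean : rieszMean lam k a x s = ((x ^ (-k) * (Real.Gamma (k + 1) / (2 * Real.pi)) : ℝ) : ℂ) *
      perronIntegral f k (1 / x) s x := by
    rw [h.perronIntegral_eq hf hA hl hd ha hk (by positivity) hs x,
      h.rieszMean_eq_sum_below hx0 le_rfl, ← mul_assoc, ← Complex.ofReal_mul, Finset.mul_sum]
    refine Finset.sum_congr rfl fun n _ => ?_
    have : x ^ (-k) * (Real.Gamma (k + 1) / (2 * Real.pi)) *
        (2 * Real.pi / Real.Gamma (k + 1)) = x ^ (-k) := by
      field_simp
    rw [this, truncPow_one_sub_div hx0]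
    push_cast
    ring
  have hint : ‖perronIntegral f k (1 / x) s x‖ ≤
      A * (1 + ‖s‖) ^ l * (x + 1) ^ l * Real.exp 1 * (x ^ (k - l) * J) := by
    have hle := MeasureTheory.norm_integral_le_of_norm_le
      ((integrable_norm_vline_rpow_neg (c := 1 / x) (r := k + 1 - l) (by positivity)
        (by linarith)).const_mul _)
      (Eventually.of_forall fun t =>
        hf.norm_mul_perronKernel_le hA hl k (by positivity : 0 < 1 / x) hs x t)
    rw [MeasureTheory.integral_const_mul, integral_norm_vline_inv_rpow_neg hx0, one_div_one_div,
      one_div_mul_cancel hx0.ne', show k + 1 - l - 1 = k - l by ring] at hle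
    exact hle
  rw [hmean, norm_mul, Complex.norm_real, Real.norm_of_nonneg (by positivity)]
  -- The normalisation, the growth of `f` and the rescaled integral balance: only `(1 / x + 1) ^ l`
  -- remains, which decreases in `x`.
  have hpow : x ^ (-k) * (x + 1) ^ l * x ^ (k - l) = (1 / x + 1) ^ l := by
    have : 1 / x + 1 = (x + 1) * x⁻¹ := by field_simp; ring
    rw [this, Real.mul_rpow (by positivity) (by positivity), Real.inv_rpow hx0.le,
      ← Real.rpow_neg hx0.le, mul_right_comm, ← Real.rpow_add hx0, mul_comm]
    congr 2
    ring
  calc _ ≤ x ^ (-k) * (Real.Gamma (k + 1) / (2 * Real.pi)) *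
        (A * (1 + ‖s‖) ^ l * (x + 1) ^ l * Real.exp 1 * (x ^ (k - l) * J)) := by gcongr
    _ = Real.Gamma (k + 1) / (2 * Real.pi) * (x ^ (-k) * (x + 1) ^ l * x ^ (k - l)) *
        Real.exp 1 * J * A * (1 + ‖s‖) ^ l := by ring
    _ ≤ _ := by
        rw [hpow]
        gcongr

theorem truncPow_mono {K : ℝ} (hK : 0 ≤ K) : Monotone (truncPow K) := by
  intro y₁ y₂ hy
  rcases le_or_gt y₁ 0 with h | h
  · rw [truncPow_of_nonpos h]
    exact truncPow_nonneg _ _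
  · rw [truncPow_of_pos h, truncPow_of_pos (h.trans_le hy)]
    exact Real.rpow_le_rpow h.le hy hK

/-- Short Riesz means consist of at most one term and are dominated by the one of length
`lam 1`. -/
theorem IsFrequency.norm_rieszMean_le_norm_rieszMean_one {lam : ℕ → ℝ} (h : IsFrequency lam)
    {k : ℝ} (hk : 0 ≤ k) (a : ℕ → ℂ) (s : ℂ) {x : ℝ} (hx : 0 < x) (hx1 : x ≤ lam 1) :
    ‖rieszMean lam k a x s‖ ≤ ‖rieszMean lam k a (lam 1) s‖ := by
  have hS : ∀ y ≤ lam 1, ∀ n, lam n < y → n ∈ ({0} : Finset ℕ) := by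
    intro y hy n hn
    have : n < 1 := h.strictMono.lt_iff_lt.1 (hn.trans_le hy)
    simp
    omega
  rw [rieszMean_eq_sum hx (hS x hx1), rieszMean_eq_sum (hx.trans_le hx1) (hS _ le_rfl),
    Finset.sum_singleton, Finset.sum_singleton, norm_mul, norm_mul _ (truncPow k _ : ℂ),
    Complex.norm_real, Complex.norm_real, Real.norm_of_nonneg (truncPow_nonneg _ _),
    Real.norm_of_nonneg (truncPow_nonneg _ _)]
  refine mul_le_mul_of_nonneg_left (truncPow_mono hk ?_) (norm_nonneg _)
  have := div_le_div_of_nonneg_left (h.nonneg 0) hx hx1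
  linarith

theorem MemHInfty.hasGrowthBound {lam : ℕ → ℝ} {l : ℝ} {f : ℂ → ℂ} (hf : MemHInfty lam l f) :
    HasGrowthBound l (growthNorm l f).toReal f := by
  intro s hs
  have h1 : ENNReal.ofReal (‖f s‖ / (1 + ‖s‖) ^ l) ≤ growthNorm l f :=
    le_iSup₂ (f := fun s (_ : s ∈ rightHalfPlane) =>
      ENNReal.ofReal (‖f s‖ / (1 + ‖s‖) ^ l)) s hs
  rw [ENNReal.ofReal_le_iff_le_toReal hf.growthNorm_lt_top.ne] at h1
  exact (div_le_iff₀ (by positivity)).1 h1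

/-- Uniform bound for the Riesz means on the closed right half-plane. -/
theorem IsFrequency.exists_norm_rieszMean_le {lam : ℕ → ℝ} (h : IsFrequency lam) {k l : ℝ}
    (hl : 0 ≤ l) (hkl : l < k) :
    ∃ C : ℝ, 0 < C ∧ ∀ f : ℂ → ℂ, MemHInfty lam l f → ∀ a : ℕ → ℂ, IsRieszGerm lam a f →
      ∀ x : ℝ, 0 < x → ∀ s : ℂ, 0 ≤ s.re →
        ‖rieszMean lam k a x s‖ ≤ C * (growthNorm l f).toReal * (1 + ‖s‖) ^ l := by
  -- Indices start at `0` and `lam 0` may vanish, so `lam 1` is the first frequency known to be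
  -- positive; it serves as the threshold between short and long means.
  have hlam1 : 0 < lam 1 := (h.nonneg 0).trans_lt (h.strictMono one_pos)
  have hΓ : 0 < Real.Gamma (k + 1) := Real.Gamma_pos_of_pos (by linarith)
  set J := ∫ t : ℝ, ‖vline 1 t‖ ^ (-(k + 1 - l))
  have hJ : 0 ≤ J := MeasureTheory.integral_nonneg fun t => by positivity
  set C := Real.Gamma (k + 1) / (2 * Real.pi) * (1 / lam 1 + 1) ^ l * Real.exp 1 * J
  have hC : 0 ≤ C := by positivity
  -- Adding `1` makes the constant positive without showing that `J` is.
  refine ⟨C + 1, by linarith, fun f hf a ha x hx => ?_⟩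
  set A := (growthNorm l f).toReal
  have hA : 0 ≤ A := ENNReal.toReal_nonneg
  have hopen : ∀ s ∈ rightHalfPlane,
      ‖rieszMean lam k a x s‖ ≤ (C + 1) * A * (1 + ‖s‖) ^ l := by
    intro s hs
    have hlong : ∀ y, lam 1 ≤ y → ‖rieszMean lam k a y s‖ ≤ (C + 1) * A * (1 + ‖s‖) ^ l :=
      fun y hy => (h.norm_rieszMean_le_of_le hf.hasGrowthBound hA hl hf.differentiableOn ha hkl
        hlam1 hy hs).trans (by gcongr; linarith)
    rcases le_total (lam 1) x with hx1 | hx1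
    · exact hlong x hx1
    · exact (h.norm_rieszMean_le_norm_rieszMean_one (by linarith) a s hx hx1).trans
        (hlong _ le_rfl)
  have hcont : Continuous fun s : ℂ => ‖rieszMean lam k a x s‖ := by
    simp_rw [h.rieszMean_eq_sum_below hx le_rfl]
    fun_prop
  have hcont' : Continuous fun s : ℂ => (C + 1) * A * (1 + ‖s‖) ^ l :=
    continuous_const.mul ((continuous_const.add continuous_norm).rpow_const fun _ => Or.inr hl)
  intro s hs
  -- Both sides are continuous in `s`, so the bound passes to the imaginary axis, as the case `σ =
  -- 0` requires.
  refine closure_minimal (t := {s : ℂ | ‖rieszMean lam k a x s‖ ≤ (C + 1) * A * (1 + ‖s‖) ^ l})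
    hopen (isClosed_le hcont hcont') ?_
  rw [rightHalfPlane, Complex.closure_setOfPred_lt_re]
  exact hs

theorem theoremT1 (lam : ℕ → ℝ) (hlam : IsFrequency lam) (k l : ℝ) (hl : 0 ≤ l) (hkl : l < k) :
    (∃ C : ℝ, 0 < C ∧
      ∀ f : ℂ → ℂ, MemHInfty lam l f → ∀ a : ℕ → ℂ, IsRieszGerm lam a f →
        (⨆ x : ℝ, ⨆ _ : 0 < x, growthNorm l (rieszMean lam k a x))
          ≤ ENNReal.ofReal C * growthNorm l f) ∧
    (∀ σ : ℝ, 0 ≤ σ → ∃ C : ℝ, 0 < C ∧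
      ∀ f : ℂ → ℂ, MemHInfty lam l f → ∀ a : ℕ → ℂ, IsRieszGerm lam a f → ∀ t : ℝ,
        (⨆ x : ℝ, ⨆ _ : 0 < x,
            ENNReal.ofReal ‖rieszMean lam k a x ((σ : ℂ) + (t : ℂ) * Complex.I)‖)
          ≤ ENNReal.ofReal (C * (1 + |t|) ^ l) * growthNorm l f) := by
  obtain ⟨C, hC, hbound⟩ := hlam.exists_norm_rieszMean_le hl hkl
  -- The factor `(1 + σ) ^ l` comes from `1 + |σ + it| ≤ (1 + σ) * (1 + |t|)`.
  refine ⟨⟨C, hC, fun f hf a ha => ?_⟩, fun σ hσ => ⟨C * (1 + σ) ^ l, by positivity,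
    fun f hf a ha t => ?_⟩⟩
  · refine iSup₂_le fun x hx => iSup₂_le fun s hs => ?_
    have hs : 0 < s.re := hs
    rw [← ENNReal.ofReal_toReal hf.growthNorm_lt_top.ne, ← ENNReal.ofReal_mul hC.le]
    exact ENNReal.ofReal_le_ofReal
      ((div_le_iff₀ (by positivity)).2 (hbound f hf a ha x hx s hs.le))
  · refine iSup₂_le fun x hx => ?_
    rw [← ENNReal.ofReal_toReal hf.growthNorm_lt_top.ne, ← ENNReal.ofReal_mul (by positivity)]
    refine ENNReal.ofReal_le_ofReal ((hbound f hf a ha x hx _ (by simpa using hσ)).trans ?_)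
    have hnorm : 1 + ‖(σ : ℂ) + (t : ℂ) * Complex.I‖ ≤ (1 + σ) * (1 + |t|) := by
      have h1 := norm_add_le (σ : ℂ) ((t : ℂ) * Complex.I)
      rw [norm_mul, Complex.norm_I, mul_one, Complex.norm_real, Complex.norm_real,
        Real.norm_of_nonneg hσ, Real.norm_eq_abs] at h1
      nlinarith [abs_nonneg t]
    calc _ ≤ C * (growthNorm l f).toReal * ((1 + σ) * (1 + |t|)) ^ l := by gcongr
      _ = _ := by
        rw [Real.mul_rpow (by positivity) (by positivity)]
        ring
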